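/- **Setting.** Let $d\ge 2$ be an integer, $[d]=\{1,\dots,d\}$, $\mathcal P([d])$ the probability simplex in $\mathbb R^d$, $\mathcal M_0=\{m\in\mathbb R^d:\sum_x m_x=0\}$, $|\cdot|$ the Euclidean norm, and $\Delta_x p=(p_y-p_x)_{y\in[d]}$. Let $\mathbb A=[\mathfrak a_l,\mathfrak a_u]$ with $0<\mathfrak a_l<\mathfrak a_u<\infty$. A rate vector at $x$ is $a\in\mathbb R^d$ with $a_y\in\mathbb A$ for $y\ne x$ and $a_x=-\sum_{y\neq x}a_y$; $\mathcal Q[\mathbb A]$ is the set of $d\times d$ matrices whose $x$-th row is a rate vector at $x$ for every $x$. Let $f(x,a)$ and $F(x,\eta)$ be real-valued costs ($x\in[d]$, $a$ a rate vector at $x$, $\eta\in\mathcal P([d])$), and $H(x,p)=\inf_a\{f(x,a)+a\cdot p\}$ over the rate vectors $a$ at $x$. Assume: * for all $(x,p)\in[d]\times\mathbb R^d$ the infimum in $H(x,p)$ is attained at exactly one rate vector $\gamma^*(x,p)$, and $\gamma^*$ is measurable; * $F(x,\cdot)$ is continuously differentiable on $\mathcal P([d])$: the one-sided derivatives $D^\eta_{yz}F(x,\eta)=\lim_{h\to0^+}\big(F(x,\eta+h(e_z-e_y))-F(x,\eta)\big)/h$,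 for $y\ne z$ and $\eta_y>0$, exist and extend continuously to $\mathcal P([d])$; moreover $D^\eta F(x,\cdot)$ is Lipschitz; * $\sum_x (F(x,\eta)-F(x,\hat\eta))(\eta_x-\hat\eta_x)\ge0$ for all $\eta,\hat\eta\in\mathcal P([d])$; * $H(x,\cdot)$ is $\mathcal C^2$; for every $K>0$, $D_pH$ and $D^2_{pp}H$ are Lipschitz in $p$ on $[-K,K]^d$, and there is $C_{2,H}>0$ (which may depend on $K$) with $\xi\cdot D^2_{pp}H(x,p)\xi\le -C_{2,H}|\xi|^2$ for all $x\in[d]$, $p\in[-K,K]^d$ and all $\xi\in\mathbb R^d$ with $\xi_x=0$. The *stationary discounted MFG system* with discount factor $r>0$, for $(\bar u^r,\bar\mu^r)\in\mathbb R^d\times\mathcal P([d])$, is $$-r\bar u^r_x+H(x,\Delta_x\bar u^r)+F(x,\bar\mu^r)=0,\qquad \sum_{y}\bar\mu^r_y\gamma^*_x(y,\Delta_y\bar u^r)=0\qquad(x\in[d]).$$ The *ergodic MFG system*, for $(\bar\varrho,\bar u,\bar\mu)\in\mathbb R\times\mathcal M_0\times\mathcal P([d])$, is $$-\bar\varrho+H(x,\Delta_x\bar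 u)+F(x,\bar\mu)=0,\qquad \sum_{y}\bar\mu_y\gamma^*_x(y,\Delta_y\bar u)=0\qquad(x\in[d]).$$ Fix any filtered probability space that carries, for every $\alpha\in\mathcal Q[\mathbb A]$, a jump process (càdlàg, adapted Markov chain with respect to the filtration) $X^\alpha$ on $[d]$ with rate matrix $\alpha$ and $X^\alpha_0=x_0\in[d]$. For a flow $\mu:\mathbb R_+\to\mathcal P([d])$ let $$J_0(\alpha,\mu)=\limsup_{T\to\infty}\frac1T\,\mathbb E\int_0^T\{f(X^\alpha_t,\alpha_{X^\alpha_t})+F(X^\alpha_t,\mu(t))\}\,dt,$$ where $\alpha_x$ is the $x$-th row of $\alpha$. A *stationary ergodic mean field equilibrium* (MFE) starting at $x_0$ is a pair $(\alpha,\mu)\in\mathcal Q[\mathbb A]\times\mathcal C^1(\mathbb R_+,\mathcal P([d]))$ such that $\mathbb P\circ(X^{\alpha}_t)^{-1}=\mu(t)$ for all $t\ge0$ and $J_0(\alpha,\mu)\le J_0(\alpha',\mu)$ for all $\alpha'\in\mathcal Q[\mathbb A]$. **Proposition (Stationary Systems).** There exists $r_0>0$ such that the following holds. 1. For every $r\in(0,r_0)$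 the stationary discounted MFG system has a unique solution $(\bar u^r,\bar\mu^r)\in\mathbb R^d\times\mathcal P([d])$. There is $C>0$ such that for all $r\in(0,r_0)$: $|r\bar u^r|\le C$, and $\bar\mu^r_x\ge C^{-1}$ for all $x\in[d]$. If moreover $f(x,a)+F(x,\eta)>0$ for all $x\in[d]$, rate vectors $a$ at $x$ and $\eta\in\mathcal P([d])$, then $\bar u^r\in(0,\infty)^d$ for all $r\in(0,r_0)$. 2. The ergodic MFG system has a unique solution $(\bar\varrho,\bar u,\bar\mu)\in\mathbb R\times\mathcal M_0\times\mathcal P([d])$. There is $C>0$ such that for all $r\in(0,r_0)$, $$\max_{x}|r\bar u^r_x-\bar\varrho|+\Big(\sum_{x}|\Delta_x(\bar u^r-\bar u)|^2\Big)^{1/2}+|\bar\mu^r-\bar\mu|\le C r^{1/2}.$$ Moreover $\bar\mu_x>0$ for all $x\in[d]$. 3. For every $x_0\in[d]$: let $\bar\alpha_{xy}=\gamma^*_y(x,\Delta_x\bar u)$ and $\mu(t)=\mathbb P\circ(X^{\bar\alpha}_t)^{-1}$. Then $(\bar\alpha,\mu)$ is a stationary ergodic MFE starting at $x_0$. Conversely,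 if $(\tilde\alpha,\tilde\mu)$ is any stationary ergodic MFE starting at $x_0$, then $\tilde\alpha=\bar\alpha$, $\tilde\mu(t)\to\bar\mu$ as $t\to\infty$, and $\bar\varrho=J_0(\tilde\alpha,\tilde\mu)$. -/

import Mathlib

open MeasureTheory Filter Topology
open scoped NNReal

namespace FiniteMFG

/-- Data of the finite-state mean field game on the state space `Fin d`: the bounds of the action set
`[al, au]`, the running cost `f x a` and the mean field cost `F x η`. The function `F x` only matters
on the simplex. The function `f x` only matters on rate vectors, where the `x`-th entry is determined
by the other ones. -/
structure Data (d : ℕ) where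
  al : ℝ
  au : ℝ
  f : Fin d → (Fin d → ℝ) → ℝ
  F : Fin d → (Fin d → ℝ) → ℝ

variable {d : ℕ}

/-- Euclidean norm on `ℝ^d`. -/
noncomputable def eucl (v : Fin d → ℝ) : ℝ := Real.sqrt (∑ x, v x ^ 2)

/-- `Δ_x p = (p_y - p_x)_y`. -/
def diff (x : Fin d) (p : Fin d → ℝ) : Fin d → ℝ := fun y => p y - p x

/-- `|Δ p| = (∑_x |Δ_x p|²)^{1/2}`. -/
noncomputable def diffNorm (p : Fin d → ℝ) : ℝ := Real.sqrt (∑ x, eucl (diff x p) ^ 2)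

/-- `e_{yz} = e_z - e_y`. -/
def edge (y z : Fin d) : Fin d → ℝ := Pi.single z 1 - Pi.single y 1

/-- `D η y z` is the derivative `D^η_{yz} K (η)` of `K` on the simplex. The quotient only makes sense
when `η + h e_{yz}` stays in the simplex for small `h > 0`, that is, when `η_y > 0`. -/
def HasSimplexDeriv (K : (Fin d → ℝ) → ℝ) (D : (Fin d → ℝ) → Fin d → Fin d → ℝ) : Prop :=
  ∀ η ∈ stdSimplex ℝ (Fin d), ∀ y z, y ≠ z → 0 < η y →
    Tendsto (fun h : ℝ => (K (η + h • edge y z) - K η) / h) (𝓝[>] 0) (𝓝 (D η y z))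

namespace Data

variable (M : Data d)

/-- Rate vectors at the state `x`. -/
def rateVectors (x : Fin d) : Set (Fin d → ℝ) :=
  {a | (∀ y, y ≠ x → a y ∈ Set.Icc M.al M.au) ∧ a x = -∑ y ∈ Finset.univ.erase x, a y}

/-- The set `Q[A]` of rate matrices with rates in the action set, that is, the set of
stationary Markovian controls. -/
def controls : Set (Matrix (Fin d) (Fin d) ℝ) :=
  {α | (∀ x y, x ≠ y → α x y ∈ Set.Icc M.al M.au) ∧ ∀ x, ∑ z, α x z = 0}

/-- The Hamiltonian `H(x,p) = inf_a {f(x,a) + a·p}`, over rate vectors `a` at `x`. -/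
noncomputable def H (x : Fin d) (p : Fin d → ℝ) : ℝ :=
  sInf ((fun a => M.f x a + ∑ y, a y * p y) '' M.rateVectors x)

/-- The rate vector `a` attains the infimum in `H(x,p)`. -/
def IsOptimalRate (x : Fin d) (p a : Fin d → ℝ) : Prop :=
  a ∈ M.rateVectors x ∧
    ∀ b ∈ M.rateVectors x, M.f x a + ∑ y, a y * p y ≤ M.f x b + ∑ y, b y * p y

/-- The optimal rate selector `γ*(x,p)`. -/
noncomputable def gammaStar (x : Fin d) (p : Fin d → ℝ) : Fin d → ℝ :=
  Classical.epsilon (M.IsOptimalRate x p)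

/-- Standing assumptions on the model. -/
structure Assumptions : Prop where
  /-- The action set is `[al, au]` with `0 < al < au`. -/
  al_pos : 0 < M.al
  al_lt_au : M.al < M.au
  /-- There is a unique optimal rate selector, and it is measurable. -/
  existsUnique_optimal : ∀ x p, ∃! a, M.IsOptimalRate x p a
  measurable_gammaStar : ∀ x, Measurable (M.gammaStar x)
  /-- `F(x,·)` is continuously differentiable on the simplex with Lipschitz derivative. -/
  F_regular : ∀ x, ∃ D, HasSimplexDeriv (M.F x) D ∧
    ContinuousOn D (stdSimplex ℝ (Fin d)) ∧ ∃ L, LipschitzOnWith L D (stdSimplex ℝ (Fin d))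
  /-- Lasry--Lions monotonicity. -/
  F_monotone : ∀ η ∈ stdSimplex ℝ (Fin d), ∀ η' ∈ stdSimplex ℝ (Fin d),
    0 ≤ ∑ x, (M.F x η - M.F x η') * (η x - η' x)
  /-- `H` is `C²` in `p`. -/
  H_contDiff : ∀ x, ContDiff ℝ 2 (M.H x)
  /-- On every box `[-K,K]^d` the derivatives `D_p H` and `D²_pp H` are Lipschitz in `p`. -/
  H_lipschitz : ∀ x, ∀ K : ℝ, 0 < K →
    (∃ L, LipschitzOnWith L (fderiv ℝ (M.H x)) (Set.Icc (fun _ => -K) (fun _ => K))) ∧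
    ∃ L, LipschitzOnWith L (fderiv ℝ (fderiv ℝ (M.H x))) (Set.Icc (fun _ => -K) (fun _ => K))
  /-- On every box `[-K,K]^d` one has `D²_pp H(x,p) ≤ -C` for some `C > 0`. Since `H(x,·)` is invariant
  under adding constants to `p`, the quadratic form is considered on the vectors with vanishing
  `x`-th entry, which is where all `Δ_x u` live. -/
  H_concave : ∀ K : ℝ, 0 < K → ∃ C : ℝ, 0 < C ∧
    ∀ x, ∀ p ∈ Set.Icc (fun _ : Fin d => -K) (fun _ => K), ∀ ξ : Fin d → ℝ, ξ x = 0 →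
      fderiv ℝ (fderiv ℝ (M.H x)) p ξ ξ ≤ -C * eucl ξ ^ 2

/-- `(u, μ) ∈ ℝ^d × P([d])` solves the stationary discounted MFG system with discount factor `r`. -/
def IsStatDiscountedSol (r : ℝ) (u μ : Fin d → ℝ) : Prop :=
  μ ∈ stdSimplex ℝ (Fin d) ∧
  (∀ x, -(r * u x) + M.H x (diff x u) + M.F x μ = 0) ∧
  ∀ x, ∑ y, μ y * M.gammaStar y (diff y u) x = 0

/-- `(ϱ, u, μ) ∈ ℝ × M_0 × P([d])` solves the ergodic MFG system. -/
def IsErgodicSol (ϱ : ℝ) (u μ : Fin d → ℝ) : Prop :=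
  ∑ x, u x = 0 ∧ μ ∈ stdSimplex ℝ (Fin d) ∧
  (∀ x, -ϱ + M.H x (diff x u) + M.F x μ = 0) ∧
  ∀ x, ∑ y, μ y * M.gammaStar y (diff y u) x = 0

/-- The stationary control `α_{xy} = γ*_y(x, Δ_x u)`. -/
noncomputable def feedback (u : Fin d → ℝ) : Matrix (Fin d) (Fin d) ℝ :=
  Matrix.of fun x y => M.gammaStar x (diff x u) y

end Data

section Dynamics

variable {Ω : Type*} {mΩ : MeasurableSpace Ω}

/-- On the filtered probability space `(Ω, ℱ, P)`, `X` is a jump process (continuous-time Markov chain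
with right-continuous paths with left limits) with rate matrix `α` and initial state `x₀`:
it is adapted, and given `ℱ s` the probability of being in `y` at time `t ≥ s` is
`exp((t - s) α)_{X_s, y}`. -/
structure IsJumpProcess (P : Measure Ω) (ℱ : Filtration ℝ≥0 mΩ) (α : Matrix (Fin d) (Fin d) ℝ)
    (x₀ : Fin d) (X : ℝ≥0 → Ω → Fin d) : Prop where
  adapted : ∀ t, Measurable[ℱ t] (X t)
  start : ∀ᵐ ω ∂P, X 0 ω = x₀
  right_cont : ∀ ω t, ContinuousWithinAt (fun s => X s ω) (Set.Ici t) t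
  left_lim : ∀ ω t, ∃ y, Tendsto (fun s => X s ω) (𝓝[<] t) (𝓝 y)
  markov : ∀ s t : ℝ≥0, s ≤ t → ∀ y,
    P[{ω | X t ω = y}.indicator (fun _ => (1 : ℝ)) | ℱ s] =ᵐ[P]
      fun ω => NormedSpace.exp (((t : ℝ) - (s : ℝ)) • α) (X s ω) y

/-- The flow of distributions `t ↦ P ∘ X_t⁻¹` (for `t ≥ 0`), as a function with values in `ℝ^d`. -/
noncomputable def lawFlow (P : Measure Ω) (X : ℝ≥0 → Ω → Fin d) (t : ℝ) : Fin d → ℝ :=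
  fun x => P.real {ω | X t.toNNReal ω = x}

/-- The ergodic cost
`J₀(α,μ) = limsup_{T → ∞} (1/T) E[∫₀ᵀ (f(X_t, α(X_t)) + F(X_t, μ(t))) dt]` for the process `X`. -/
noncomputable def Data.ergodicCost (M : Data d) (P : Measure Ω) (X : ℝ≥0 → Ω → Fin d)
    (α : Matrix (Fin d) (Fin d) ℝ) (μ : ℝ → Fin d → ℝ) : ℝ :=
  limsup (fun T : ℝ => (1 / T) * ∫ ω, (∫ t in (0 : ℝ)..T,
    (M.f (X t.toNNReal ω) (α (X t.toNNReal ω)) + M.F (X t.toNNReal ω) (μ t))) ∂P) atTop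

/-- `(α, μ) ∈ A_s × C¹(ℝ_+, P([d]))` is a stationary ergodic mean field equilibrium, where `X β` is
the jump process of the representative player using the stationary Markovian control `β`
(the initial state is built into `X`). -/
structure Data.IsStationaryErgodicMFE (M : Data d) (P : Measure Ω)
    (X : Matrix (Fin d) (Fin d) ℝ → ℝ≥0 → Ω → Fin d)
    (α : Matrix (Fin d) (Fin d) ℝ) (μ : ℝ → Fin d → ℝ) : Prop where
  control : α ∈ M.controls
  flow_mem : ∀ t, 0 ≤ t → μ t ∈ stdSimplex ℝ (Fin d)
  flow_C1 : ContDiffOn ℝ 1 μ (Set.Ici 0)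
  law : ∀ t, 0 ≤ t → lawFlow P (X α) t = μ t
  optimal : ∀ β ∈ M.controls, M.ergodicCost P (X α) α μ ≤ M.ergodicCost P (X β) β μ

end Dynamics

end FiniteMFG

/-! Everything reduces to one family of problems: the ergodic system whose coupling `F` is lowered
by a fixed vector `w`. The ergodic MFG system is the case `w = 0`. If `v` is the centered potential
of a discounted solution and `m` its mean, then `v` solves the case `w = r • v` with ergodic
constant `r * m`.

Existence for a fixed `w` (`exists_isErgodicTriple`): the Hamilton–Jacobi residual, paired with `μ`,
and minus the stationarity residual, paired with `u`, form a monotone operator on the simplex times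
a box of centered potentials, by Lasry–Lions duality and concavity of `H`. Minty's method solves the
variational inequality, and an oscillation estimate shows that the box constraint is inactive.

Stability (`exists_stability`, `exists_uniform_constants`): all rates are at least `al`, so
stationary distributions are bounded below. Duality and strong concavity of `H` then bound `diffNorm
(u - u') ^ 2` by `‖w - w'‖` times the distance of `μ` and `μ'`, while the stationarity equations
bound that distance by `diffNorm (u - u')`. So solutions are Lipschitz in `w`. This gives
uniqueness, makes `w ↦ r • u` a contraction for small `r`, and yields convergence at rate `r`, which
is better than `r ^ (1 / 2)`.

Equilibria: the chains forget their initial state exponentially fast, so the ergodic cost against a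
convergent flow is a stationary cost. That cost equals `ϱ` plus the average defect of optimality in
the Hamiltonian (`stationary_cost_eq`), which settles verification. For the converse, the coupling
is frozen at the limit of the equilibrium flow. Optimality forces the control to be the feedback of
the frozen problem, so the limit solves the ergodic MFG system, and uniqueness applies. -/

namespace FiniteMFG

variable {d : ℕ}

/-! ### Rate matrices and their stationary distributions. -/

/-- Multiplication by a rate matrix with off-diagonal rates at least `l` is bounded below on vectors
of total mass zero. -/
theorem card_mul_sum_abs_le {α : Matrix (Fin d) (Fin d) ℝ} {l : ℝ}
    (hl : ∀ x y, x ≠ y → l ≤ α x y) (hrow : ∀ x, ∑ y, α x y = 0)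
    {ν : Fin d → ℝ} (hν : ∑ x, ν x = 0) :
    d * l * ∑ x, |ν x| ≤ ∑ x, |∑ y, ν y * α y x| := by
  -- `s` is the sign vector of `ν`. Since `ν` has mass zero, `l` may be subtracted from every entry
  -- of `α` for free; the off-diagonal entries stay nonnegative and each row then sums to `-d * l`.
  obtain ⟨s, hs1, hs2⟩ : ∃ s : Fin d → ℝ, (∀ x, |s x| ≤ 1) ∧ ∀ x, s x * ν x = |ν x| := by
    refine ⟨fun x => if 0 ≤ ν x then 1 else -1, fun x => ?_, fun x => ?_⟩
    · dsimp only; split_ifs <;> simp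
    · dsimp only; split_ifs with h
      · rw [abs_of_nonneg h, one_mul]
      · rw [abs_of_neg (not_le.1 h)]; ring
  have h1 : ∀ y x, -(|ν y| * (α y x - l)) ≤ -(ν y * s x * (α y x - l)) := by
    intro y x
    by_cases hxy : y = x
    · subst hxy
      rw [mul_comm (ν y), hs2]
    · have : 0 ≤ α y x - l := sub_nonneg.2 (hl y x hxy)
      have h2 : ν y * s x ≤ |ν y| := by
        calc ν y * s x ≤ |ν y * s x| := le_abs_self _
          _ = |ν y| * |s x| := abs_mul _ _
          _ ≤ |ν y| * 1 := by gcongr; exact hs1 x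
          _ = _ := mul_one _
      nlinarith
  have h2 : ∑ y, ∑ x, -(|ν y| * (α y x - l)) = d * l * ∑ x, |ν x| := by
    rw [Finset.mul_sum]
    refine Finset.sum_congr rfl fun y _ => ?_
    rw [Finset.sum_neg_distrib, ← Finset.mul_sum, Finset.sum_sub_distrib, hrow]
    simp; ring
  have h3 : ∑ y, ∑ x, -(ν y * s x * (α y x - l)) = -∑ x, s x * ∑ y, ν y * α y x := by
    rw [Finset.sum_comm, ← Finset.sum_neg_distrib]
    refine Finset.sum_congr rfl fun x _ => ?_
    have : ∑ y, -(ν y * s x * (α y x - l)) = -(s x * ∑ y, ν y * α y x) + s x * l * ∑ y, ν y := by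
      rw [Finset.mul_sum, Finset.mul_sum, ← Finset.sum_neg_distrib, ← Finset.sum_add_distrib]
      exact Finset.sum_congr rfl fun y _ => by ring
    rw [this, hν]; ring
  rw [← h2]
  calc _ ≤ ∑ y, ∑ x, -(ν y * s x * (α y x - l)) :=
        Finset.sum_le_sum fun y _ => Finset.sum_le_sum fun x _ => h1 y x
    _ = ∑ x, -(s x * ∑ y, ν y * α y x) := by rw [h3, Finset.sum_neg_distrib]
    _ ≤ _ := Finset.sum_le_sum fun x _ => by
        calc -(s x * ∑ y, ν y * α y x) ≤ |s x * ∑ y, ν y * α y x| := neg_le_abs _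
          _ = |s x| * |∑ y, ν y * α y x| := abs_mul _ _
          _ ≤ 1 * |∑ y, ν y * α y x| := by gcongr; exact hs1 x
          _ = _ := one_mul _

/-- Lower bound for stationary distributions. -/
theorem le_of_stationary {α : Matrix (Fin d) (Fin d) ℝ} {l b : ℝ} (hl0 : 0 < l)
    (hl : ∀ x y, x ≠ y → l ≤ α x y) (hb : ∀ x, -b ≤ α x x) (hb0 : 0 ≤ b)
    {μ : Fin d → ℝ} (hμ : μ ∈ stdSimplex ℝ (Fin d)) (hs : ∀ x, ∑ y, μ y * α y x = 0) (x : Fin d) :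
    l / (l + b) ≤ μ x := by
  -- Balance at `x`: the outflow is at most `b * μ x`, the inflow at least `l * (1 - μ x)`.
  have h1 := hs x
  rw [← Finset.add_sum_erase _ _ (Finset.mem_univ x)] at h1
  have h2 : l * ∑ y ∈ Finset.univ.erase x, μ y ≤ ∑ y ∈ Finset.univ.erase x, μ y * α y x := by
    rw [Finset.mul_sum]
    refine Finset.sum_le_sum fun y hy => ?_
    rw [mul_comm]
    exact mul_le_mul_of_nonneg_left (hl y x (Finset.ne_of_mem_erase hy)) (hμ.1 y)
  have h3 : μ x + ∑ y ∈ Finset.univ.erase x, μ y = 1 := by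
    rw [Finset.add_sum_erase _ _ (Finset.mem_univ x)]; exact hμ.2
  rw [div_le_iff₀ (by positivity)]
  have h4 := mul_le_mul_of_nonneg_left (hb x) (hμ.1 x)
  have h5 : ∑ y ∈ Finset.univ.erase x, μ y = 1 - μ x := by linarith
  rw [h5] at h2
  nlinarith

/-- A rate matrix with positive rates has a stationary distribution. -/
theorem exists_stationary (hd : 0 < d) {α : Matrix (Fin d) (Fin d) ℝ} {l : ℝ} (hl0 : 0 < l)
    (hl : ∀ x y, x ≠ y → l ≤ α x y) (hrow : ∀ x, ∑ y, α x y = 0) :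
    ∃ μ ∈ stdSimplex ℝ (Fin d), ∀ x, ∑ y, μ y * α y x = 0 := by
  have : Nonempty (Fin d) := ⟨⟨0, hd⟩⟩
  -- Constants lie in the right kernel, so the left kernel is nontrivial as well.
  have hdet : α.det = 0 := by
    refine Matrix.exists_mulVec_eq_zero_iff.1 ⟨fun _ => 1, ?_, ?_⟩
    · intro h
      have := congrFun h ⟨0, hd⟩
      simp at this
    · ext x
      simpa [Matrix.mulVec, dotProduct] using hrow x
  obtain ⟨ν, hν0, hν⟩ := Matrix.exists_vecMul_eq_zero_iff.2 hdet
  have hst : ∀ x, ∑ y, ν y * α y x = 0 := fun x => congrFun hν x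
  -- the absolute values are stationary, too
  have hsplit : ∀ (w : Fin d → ℝ) x,
      w x * α x x + ∑ y ∈ Finset.univ.erase x, w y * α y x = ∑ y, w y * α y x := fun w x =>
    Finset.add_sum_erase _ (fun y => w y * α y x) (Finset.mem_univ x)
  have hdiag : ∀ x, α x x ≤ 0 := by
    intro x
    have h := hrow x
    rw [← Finset.add_sum_erase _ _ (Finset.mem_univ x)] at h
    have : 0 ≤ ∑ y ∈ Finset.univ.erase x, α x y :=
      Finset.sum_nonneg fun y hy => hl0.le.trans (hl x y (Finset.ne_of_mem_erase hy).symm)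
    linarith
  -- The triangle inequality makes every entry of `|ν| α` nonnegative. The entries add up to zero
  -- because the rows do, so all of them vanish.
  have hge : ∀ x, 0 ≤ ∑ y, |ν y| * α y x := by
    intro x
    have h1 := hst x
    rw [← hsplit] at h1 ⊢
    have h2 : |∑ y ∈ Finset.univ.erase x, ν y * α y x| ≤
        ∑ y ∈ Finset.univ.erase x, |ν y| * α y x := by
      refine (Finset.abs_sum_le_sum_abs _ _).trans_eq (Finset.sum_congr rfl fun y hy => ?_)
      rw [abs_mul, abs_of_nonneg (hl0.le.trans (hl y x (Finset.ne_of_mem_erase hy)))]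
    have h3 : ∑ y ∈ Finset.univ.erase x, ν y * α y x = -(ν x * α x x) := by linarith
    rw [h3, abs_neg, abs_mul, abs_of_nonpos (hdiag x)] at h2
    linarith
  have hsum : ∑ x, ∑ y, |ν y| * α y x = 0 := by
    rw [Finset.sum_comm]
    simp [← Finset.mul_sum, hrow]
  have habs : ∀ x, ∑ y, |ν y| * α y x = 0 := fun x =>
    (Finset.sum_eq_zero_iff_of_nonneg fun x _ => hge x).1 hsum x (Finset.mem_univ x)
  have hpos : 0 < ∑ x, |ν x| := by
    obtain ⟨x, hx⟩ := Function.ne_iff.1 hν0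
    exact Finset.sum_pos' (fun x _ => abs_nonneg _) ⟨x, Finset.mem_univ x, abs_pos.2 hx⟩
  refine ⟨fun x => |ν x| / ∑ x, |ν x|, ⟨fun x => by positivity, ?_⟩, fun x => ?_⟩
  · rw [← Finset.sum_div, div_self hpos.ne']
  · have : ∑ y, |ν y| / (∑ x, |ν x|) * α y x = (∑ y, |ν y| * α y x) / ∑ x, |ν x| := by
      rw [Finset.sum_div]
      exact Finset.sum_congr rfl fun y _ => by ring
    rw [this, habs, zero_div]

/-! ### Transition matrices and exponential ergodicity. -/

section Exponential

open scoped Matrix Matrix.Norms.Operator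

theorem hasSum_exp_entry (A : Matrix (Fin d) (Fin d) ℝ) (x y : Fin d) :
    HasSum (fun n : ℕ => (n.factorial : ℝ)⁻¹ * (A ^ n) x y) (NormedSpace.exp A x y) := by
  have h := NormedSpace.exp_series_hasSum_exp' (𝕂 := ℝ) A
  have h2 := h.mapL (LinearMap.toContinuousLinearMap (Matrix.entryLinearMap ℝ ℝ x y))
  simp only [map_smul, LinearMap.coe_toContinuousLinearMap', Matrix.entryLinearMap_apply,
    smul_eq_mul] at h2
  exact h2

theorem contDiff_exp_smul (A : Matrix (Fin d) (Fin d) ℝ) :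
    ContDiff ℝ 1 fun t : ℝ => NormedSpace.exp (t • A) := by
  have h : ContDiff ℝ 1 (NormedSpace.exp : Matrix (Fin d) (Fin d) ℝ → _) :=
    contDiff_iff_contDiffAt.2 fun x => (NormedSpace.exp_analytic (𝕂 := ℝ) x).contDiffAt
  exact h.comp (contDiff_id.smul contDiff_const)

theorem contDiff_exp_smul_row (A : Matrix (Fin d) (Fin d) ℝ) (x : Fin d) :
    ContDiff ℝ 1 fun t : ℝ => NormedSpace.exp (t • A) x := by
  have h := contDiff_exp_smul A
  let e : Matrix (Fin d) (Fin d) ℝ →ₗ[ℝ] (Fin d → ℝ) :=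
    { toFun := fun B => B x, map_add' := fun _ _ => rfl, map_smul' := fun _ _ => rfl }
  exact (LinearMap.toContinuousLinearMap e).contDiff.comp h

/-- Uniformization: multiples of the identity commute with `A`, and for large `c` the shifted matrix
has nonnegative entries, so its exponential series can be estimated term by term. -/
theorem exp_eq_smul_exp_add (A : Matrix (Fin d) (Fin d) ℝ) (c : ℝ) :
    NormedSpace.exp A = Real.exp (-c) • NormedSpace.exp (A + c • (1 : Matrix (Fin d) (Fin d) ℝ)) := by
  have h1 : NormedSpace.exp (A + c • (1 : Matrix (Fin d) (Fin d) ℝ)) =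
      NormedSpace.exp A * NormedSpace.exp (c • (1 : Matrix (Fin d) (Fin d) ℝ)) :=
    Matrix.exp_add_of_commute _ _ ((Commute.one_right A).smul_right c)
  have h2 : NormedSpace.exp (c • (1 : Matrix (Fin d) (Fin d) ℝ)) =
      Real.exp c • (1 : Matrix (Fin d) (Fin d) ℝ) := by
    have : c • (1 : Matrix (Fin d) (Fin d) ℝ) = Matrix.diagonal fun _ => c := by
      rw [Matrix.smul_one_eq_diagonal]
    rw [this, Matrix.exp_diagonal, Matrix.smul_one_eq_diagonal]
    congr 1
    ext i
    rw [Pi.coe_exp, Real.exp_eq_exp_ℝ]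
  rw [h1, h2, mul_smul_comm, mul_one, smul_smul, ← Real.exp_add]
  simp

theorem exp_row_sum {A : Matrix (Fin d) (Fin d) ℝ} (hrow : ∀ x, ∑ y, A x y = 0) (x : Fin d) :
    ∑ y, NormedSpace.exp A x y = 1 := by
  have h := hasSum_sum (s := Finset.univ) fun y _ => hasSum_exp_entry A x y
  refine h.unique ?_
  have h2 : ∀ n : ℕ, n ≠ 0 → ∑ y, (n.factorial : ℝ)⁻¹ * (A ^ n) x y = 0 := by
    intro n hn
    obtain ⟨m, rfl⟩ := Nat.exists_eq_succ_of_ne_zero hn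
    rw [← Finset.mul_sum, Nat.succ_eq_add_one, pow_succ]
    simp_rw [Matrix.mul_apply]
    rw [Finset.sum_comm]
    simp [← Finset.mul_sum, hrow]
  have h3 := hasSum_single (f := fun n : ℕ => ∑ y, (n.factorial : ℝ)⁻¹ * (A ^ n) x y) 0
    fun n hn => h2 n hn
  simpa [Matrix.one_apply] using h3

theorem exp_entry_nonneg {A : Matrix (Fin d) (Fin d) ℝ} (hA : ∀ x y, x ≠ y → 0 ≤ A x y)
    (x y : Fin d) : 0 ≤ NormedSpace.exp A x y := by
  obtain ⟨c, hc⟩ : ∃ c : ℝ, ∀ x, -A x x ≤ c :=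
    ⟨∑ x, |A x x|, fun x => (neg_le_abs _).trans
      (Finset.single_le_sum (f := fun x => |A x x|) (fun _ _ => abs_nonneg _) (Finset.mem_univ x))⟩
  have hB : ∀ x y, 0 ≤ (A + c • (1 : Matrix (Fin d) (Fin d) ℝ)) x y := by
    intro x y
    by_cases hxy : x = y
    · subst hxy; simp; linarith [hc x]
    · simp [hxy, hA x y hxy]
  have hpow : ∀ (n : ℕ) x y, 0 ≤ ((A + c • (1 : Matrix (Fin d) (Fin d) ℝ)) ^ n) x y := by
    intro n
    induction n with
    | zero => intro x y; simp only [pow_zero, Matrix.one_apply]; split_ifs <;> simp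
    | succ n ih =>
      intro x y
      rw [pow_succ, Matrix.mul_apply]
      exact Finset.sum_nonneg fun z _ => mul_nonneg (ih x z) (hB z y)
  rw [exp_eq_smul_exp_add A c, Matrix.smul_apply, smul_eq_mul]
  exact mul_nonneg (Real.exp_pos _).le ((hasSum_exp_entry _ x y).nonneg fun n =>
    mul_nonneg (by positivity) (hpow n x y))

/-- The transition matrix of a chain with rates at least `l` contracts vectors of mass zero. -/
theorem sum_abs_vecMul_exp_le {A : Matrix (Fin d) (Fin d) ℝ} {l : ℝ}
    (hl : ∀ x y, x ≠ y → l ≤ A x y) (hrow : ∀ x, ∑ y, A x y = 0)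
    {ν : Fin d → ℝ} (hν : ∑ x, ν x = 0) :
    ∑ x, |∑ y, ν y * NormedSpace.exp A y x| ≤ Real.exp (-(d * l)) * ∑ x, |ν x| := by
  obtain ⟨c, hc⟩ : ∃ c : ℝ, ∀ x, l - A x x ≤ c :=
    ⟨∑ x, |l - A x x|, fun x => (le_abs_self _).trans
      (Finset.single_le_sum (f := fun x => |l - A x x|) (fun _ _ => abs_nonneg _)
        (Finset.mem_univ x))⟩
  -- With this shift `B - l` is entrywise nonnegative with row sums `c - d * l`. It acts like `B` on
  -- vectors of mass zero, so `B` expands their ℓ¹ norm by at most `c - d * l`; the factor `exp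
  -- (-c)` finally removes the shift.
  set B := A + c • (1 : Matrix (Fin d) (Fin d) ℝ) with hBdef
  have hBl : ∀ x y, 0 ≤ B x y - l := by
    intro x y
    by_cases hxy : x = y
    · subst hxy; simp [hBdef]; linarith [hc x]
    · simp [hBdef, hxy, hl x y hxy]
  have hBrow : ∀ x, ∑ y, (B x y - l) = c - d * l := by
    intro x
    rw [Finset.sum_sub_distrib]
    simp [hBdef, Finset.sum_add_distrib, hrow, Matrix.one_apply]
  have hone : ∀ w : Fin d → ℝ, ∑ x, w x = 0 → ∑ x, (w ᵥ* B) x = 0 ∧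
      ∑ x, |(w ᵥ* B) x| ≤ (c - d * l) * ∑ x, |w x| := by
    intro w hw
    have h1 : ∀ x, (w ᵥ* B) x = ∑ y, w y * (B y x - l) := by
      intro x
      simp_rw [mul_sub, Finset.sum_sub_distrib, ← Finset.sum_mul, hw]
      simp [Matrix.vecMul, dotProduct]
    constructor
    · simp_rw [h1]
      rw [Finset.sum_comm]
      simp_rw [← Finset.mul_sum, hBrow, ← Finset.sum_mul, hw, zero_mul]
    · calc ∑ x, |(w ᵥ* B) x| ≤ ∑ x, ∑ y, |w y| * (B y x - l) := by
            refine Finset.sum_le_sum fun x _ => ?_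
            rw [h1]
            refine (Finset.abs_sum_le_sum_abs _ _).trans_eq (Finset.sum_congr rfl fun y _ => ?_)
            rw [abs_mul, abs_of_nonneg (hBl y x)]
        _ = _ := by
            rw [Finset.sum_comm]
            simp_rw [← Finset.mul_sum, hBrow, ← Finset.sum_mul]
            ring
  have hcl : 0 ≤ c - d * l ∨ d = 0 := by
    rcases Nat.eq_zero_or_pos d with h | h
    · exact Or.inr h
    · left
      rw [← hBrow ⟨0, h⟩]
      exact Finset.sum_nonneg fun y _ => hBl _ y
  rcases hcl with hcl | rfl
  swap
  · simp
  have hpow : ∀ n : ℕ, ∑ x, (ν ᵥ* B ^ n) x = 0 ∧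
      ∑ x, |(ν ᵥ* B ^ n) x| ≤ (c - d * l) ^ n * ∑ x, |ν x| := by
    intro n
    induction n with
    | zero => simp [hν]
    | succ n ih =>
      obtain ⟨h1, h2⟩ := hone _ ih.1
      rw [pow_succ, ← Matrix.vecMul_vecMul]
      refine ⟨h1, h2.trans ?_⟩
      rw [pow_succ, mul_comm ((c - d * l) ^ n), mul_assoc]
      exact mul_le_mul_of_nonneg_left ih.2 hcl
  have hlim : ∀ x, HasSum (fun n : ℕ => (n.factorial : ℝ)⁻¹ * (ν ᵥ* B ^ n) x)
      (∑ y, ν y * NormedSpace.exp B y x) := by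
    intro x
    have h := hasSum_sum (s := Finset.univ) fun y _ => (hasSum_exp_entry B y x).mul_left (ν y)
    have hfun : (fun n : ℕ => (n.factorial : ℝ)⁻¹ * (ν ᵥ* B ^ n) x) =
        fun n : ℕ => ∑ y, ν y * ((n.factorial : ℝ)⁻¹ * (B ^ n) y x) := by
      funext n
      simp_rw [Matrix.vecMul, dotProduct, Finset.mul_sum]
      exact Finset.sum_congr rfl fun y _ => mul_left_comm _ _ _
    rw [hfun]
    exact h
  have hB : ∑ x, |∑ y, ν y * NormedSpace.exp B y x| ≤ Real.exp (c - d * l) * ∑ x, |ν x| := by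
    have ht : Tendsto (fun N => ∑ x, |∑ n ∈ Finset.range N, (n.factorial : ℝ)⁻¹ * (ν ᵥ* B ^ n) x|)
        atTop (𝓝 (∑ x, |∑ y, ν y * NormedSpace.exp B y x|)) :=
      tendsto_finsetSum _ fun x _ => (hlim x).tendsto_sum_nat.abs
    refine le_of_tendsto' ht fun N => ?_
    calc _ ≤ ∑ x, ∑ n ∈ Finset.range N, (n.factorial : ℝ)⁻¹ * |(ν ᵥ* B ^ n) x| := by
          refine Finset.sum_le_sum fun x _ => (Finset.abs_sum_le_sum_abs _ _).trans_eq ?_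
          refine Finset.sum_congr rfl fun n _ => ?_
          rw [abs_mul, abs_of_nonneg (by positivity)]
      _ ≤ ∑ n ∈ Finset.range N, (c - d * l) ^ n / n.factorial * ∑ x, |ν x| := by
          rw [Finset.sum_comm]
          refine Finset.sum_le_sum fun n _ => ?_
          rw [← Finset.mul_sum, div_eq_inv_mul, mul_assoc]
          exact mul_le_mul_of_nonneg_left (hpow n).2 (by positivity)
      _ ≤ _ := by
          rw [← Finset.sum_mul]
          exact mul_le_mul_of_nonneg_right (Real.sum_le_exp_of_nonneg hcl N)
            (Finset.sum_nonneg fun _ _ => abs_nonneg _)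
  have hA : ∀ x, |∑ y, ν y * NormedSpace.exp A y x| =
      Real.exp (-c) * |∑ y, ν y * NormedSpace.exp B y x| := by
    intro x
    have h : ∑ y, ν y * NormedSpace.exp A y x =
        Real.exp (-c) * ∑ y, ν y * NormedSpace.exp B y x := by
      rw [Finset.mul_sum]
      refine Finset.sum_congr rfl fun y _ => ?_
      rw [exp_eq_smul_exp_add A c, Matrix.smul_apply, smul_eq_mul]; ring
    rw [h, abs_mul, abs_of_pos (Real.exp_pos _)]
  simp_rw [hA, ← Finset.mul_sum]
  calc _ ≤ Real.exp (-c) * (Real.exp (c - d * l) * ∑ x, |ν x|) := by gcongr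
    _ = _ := by rw [← mul_assoc, ← Real.exp_add]; ring_nf

theorem vecMul_exp_of_stationary {A : Matrix (Fin d) (Fin d) ℝ} {μ : Fin d → ℝ}
    (hs : ∀ x, ∑ y, μ y * A y x = 0) (x : Fin d) : ∑ y, μ y * NormedSpace.exp A y x = μ x := by
  have h := hasSum_sum (s := Finset.univ) fun y _ => (hasSum_exp_entry A y x).mul_left (μ y)
  refine h.unique ?_
  have h0 : μ ᵥ* A = 0 := funext hs
  have h2 : ∀ n : ℕ, n ≠ 0 → ∑ y, μ y * ((n.factorial : ℝ)⁻¹ * (A ^ n) y x) = 0 := by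
    intro n hn
    obtain ⟨m, rfl⟩ := Nat.exists_eq_succ_of_ne_zero hn
    have h3 : (μ ᵥ* A ^ (m + 1)) x = 0 := by
      rw [pow_succ', ← Matrix.vecMul_vecMul, h0, Matrix.zero_vecMul]; rfl
    simp_rw [mul_left_comm (μ _), ← Finset.mul_sum]
    rw [show ∑ y, μ y * (A ^ m.succ) y x = 0 from h3, mul_zero]
  have h3 := hasSum_single (f := fun n : ℕ => ∑ y, μ y * ((n.factorial : ℝ)⁻¹ * (A ^ n) y x)) 0
    fun n hn => h2 n hn
  simpa [Matrix.one_apply] using h3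

/-- The rows of the transition matrices converge to the stationary distribution. -/
theorem tendsto_exp_row (hd : 0 < d) {A : Matrix (Fin d) (Fin d) ℝ} {l : ℝ} (hl0 : 0 < l)
    (hl : ∀ x y, x ≠ y → l ≤ A x y) (hrow : ∀ x, ∑ y, A x y = 0)
    {μ : Fin d → ℝ} (hμ : μ ∈ stdSimplex ℝ (Fin d)) (hs : ∀ x, ∑ y, μ y * A y x = 0) (x₀ : Fin d) :
    Tendsto (fun t : ℝ => NormedSpace.exp (t • A) x₀) atTop (𝓝 μ) := by
  rw [tendsto_pi_nhds]
  intro x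
  -- The contraction is applied to the Dirac mass minus `μ`, for `t • A`, whose rates are at least
  -- `t * l`.
  set ν : Fin d → ℝ := fun y => (Pi.single x₀ (1 : ℝ) : Fin d → ℝ) y - μ y with hνdef
  have hν : ∑ y, ν y = 0 := by
    simp [hνdef, Finset.sum_sub_distrib, hμ.2]
  have hb : ∀ t : ℝ, 0 ≤ t → ‖NormedSpace.exp (t • A) x₀ x - μ x‖ ≤
      Real.exp (-(d * l) * t) * ∑ y, |ν y| := by
    intro t ht
    have h1 := sum_abs_vecMul_exp_le (A := t • A) (l := t * l)
      (fun x y hxy => by simpa using mul_le_mul_of_nonneg_left (hl x y hxy) ht)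
      (fun x => by simp [← Finset.mul_sum, hrow]) hν
    have h2 : ∑ y, ν y * NormedSpace.exp (t • A) y x = NormedSpace.exp (t • A) x₀ x - μ x := by
      have h3 : ∑ y, μ y * NormedSpace.exp (t • A) y x = μ x :=
        vecMul_exp_of_stationary
          (fun z => by simp [mul_left_comm _ t, ← Finset.mul_sum, hs]) x
      simp_rw [hνdef, sub_mul, Finset.sum_sub_distrib, h3]
      simp [Pi.single_apply]
    rw [Real.norm_eq_abs, ← h2]
    refine (Finset.single_le_sum (f := fun x => |∑ y, ν y * NormedSpace.exp (t • A) y x|)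
      (fun _ _ => abs_nonneg _) (Finset.mem_univ x)).trans (h1.trans_eq ?_)
    ring_nf
  rw [tendsto_iff_norm_sub_tendsto_zero]
  refine squeeze_zero' (Eventually.of_forall fun _ => norm_nonneg _)
    ((eventually_ge_atTop 0).mono hb) ?_
  have hdl : 0 < (d : ℝ) * l := by positivity
  have : Tendsto (fun t : ℝ => Real.exp (-(d * l) * t)) atTop (𝓝 0) :=
    Real.tendsto_exp_atBot.comp ((tendsto_const_mul_atBot_of_neg (by linarith)).2 tendsto_id)
  simpa using this.mul_const (∑ y, |ν y|)

end Exponential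

/-! ### Norms, differences and boxes. -/

theorem eucl_sq (v : Fin d → ℝ) : eucl v ^ 2 = ∑ x, v x ^ 2 :=
  Real.sq_sqrt (Finset.sum_nonneg fun _ _ => sq_nonneg _)

theorem norm_le_eucl (v : Fin d → ℝ) : ‖v‖ ≤ eucl v := by
  refine (pi_norm_le_iff_of_nonneg (Real.sqrt_nonneg _)).2 fun x => ?_
  refine Real.le_sqrt_of_sq_le ?_
  rw [Real.norm_eq_abs, sq_abs]
  exact Finset.single_le_sum (f := fun x => v x ^ 2) (fun _ _ => sq_nonneg _) (Finset.mem_univ x)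

theorem eucl_le_card_mul_norm (v : Fin d → ℝ) : eucl v ≤ d * ‖v‖ := by
  refine Real.sqrt_le_iff.2 ⟨by positivity, ?_⟩
  have h : ∀ x, v x ^ 2 ≤ ‖v‖ ^ 2 := fun x => by
    rw [← sq_abs]; exact pow_le_pow_left₀ (abs_nonneg _) (norm_le_pi_norm v x) 2
  calc ∑ x, v x ^ 2 ≤ ∑ _x : Fin d, ‖v‖ ^ 2 := Finset.sum_le_sum fun x _ => h x
    _ = d * ‖v‖ ^ 2 := by simp
    _ ≤ d ^ 2 * ‖v‖ ^ 2 := by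
        gcongr
        rcases Nat.eq_zero_or_pos d with rfl | hd
        · simp
        · have : (1 : ℝ) ≤ d := by exact_mod_cast hd
          nlinarith
    _ = _ := by ring

theorem abs_sum_mul_le (a v : Fin d → ℝ) {B : ℝ} (ha : ∀ y, |a y| ≤ B) :
    |∑ y, a y * v y| ≤ d * B * ‖v‖ := by
  refine (Finset.abs_sum_le_sum_abs _ _).trans ?_
  calc ∑ y, |a y * v y| ≤ ∑ _y : Fin d, B * ‖v‖ := Finset.sum_le_sum fun y _ => by
        rw [abs_mul]
        exact mul_le_mul (ha y) (norm_le_pi_norm v y) (abs_nonneg _) ((abs_nonneg _).trans (ha y))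
    _ = _ := by simp; ring

theorem diff_self (x : Fin d) (p : Fin d → ℝ) : diff x p x = 0 := sub_self _

theorem diff_sub (x : Fin d) (p q : Fin d → ℝ) : diff x (p - q) = diff x p - diff x q := by
  funext y; simp only [diff, Pi.sub_apply]; ring

theorem diff_add_const (x : Fin d) (p : Fin d → ℝ) (c : ℝ) :
    diff x (fun y => p y + c) = diff x p := by
  funext y; simp only [diff]; ring

theorem sum_mul_diff {a : Fin d → ℝ} (ha : ∑ y, a y = 0) (x : Fin d) (p : Fin d → ℝ) :
    ∑ y, a y * diff x p y = ∑ y, a y * p y := by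
  simp only [diff, mul_sub, Finset.sum_sub_distrib, ← Finset.sum_mul, ha]
  ring

theorem mem_box_iff {K : ℝ} {p : Fin d → ℝ} :
    p ∈ Set.Icc (fun _ : Fin d => -K) (fun _ => K) ↔ ∀ y, |p y| ≤ K := by
  simp only [Set.mem_Icc, Pi.le_def, abs_le]
  exact ⟨fun h y => ⟨h.1 y, h.2 y⟩, fun h => ⟨fun y => (h y).1, fun y => (h y).2⟩⟩

/-! ### The Hamiltonian and its optimal rates. -/

namespace Data

variable {M : Data d}

theorem sum_eq_zero_of_mem_rateVectors {x : Fin d} {a : Fin d → ℝ} (ha : a ∈ M.rateVectors x) :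
    ∑ y, a y = 0 := by
  rw [← Finset.add_sum_erase _ _ (Finset.mem_univ x), ha.2]
  ring

theorem mem_rateVectors_iff {x : Fin d} {a : Fin d → ℝ} :
    a ∈ M.rateVectors x ↔ (∀ y, y ≠ x → a y ∈ Set.Icc M.al M.au) ∧ ∑ y, a y = 0 := by
  refine ⟨fun h => ⟨h.1, sum_eq_zero_of_mem_rateVectors h⟩, fun h => ⟨h.1, ?_⟩⟩
  have := h.2
  rw [← Finset.add_sum_erase _ _ (Finset.mem_univ x)] at this
  linarith

theorem mem_controls_iff {α : Matrix (Fin d) (Fin d) ℝ} :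
    α ∈ M.controls ↔ ∀ x, α x ∈ M.rateVectors x := by
  simp only [mem_rateVectors_iff]
  exact ⟨fun h x => ⟨fun y hy => h.1 x y hy.symm, h.2 x⟩,
    fun h => ⟨fun x y hxy => (h x).1 y hxy.symm, fun x => (h x).2⟩⟩

namespace Assumptions

variable (hM : M.Assumptions)
include hM

theorem au_pos : 0 < M.au := hM.al_pos.trans hM.al_lt_au

theorem isOptimalRate_gammaStar (x : Fin d) (p : Fin d → ℝ) :
    M.IsOptimalRate x p (M.gammaStar x p) :=
  Classical.epsilon_spec (hM.existsUnique_optimal x p).exists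

theorem gammaStar_mem (x : Fin d) (p : Fin d → ℝ) : M.gammaStar x p ∈ M.rateVectors x :=
  (hM.isOptimalRate_gammaStar x p).1

theorem sum_gammaStar (x : Fin d) (p : Fin d → ℝ) : ∑ y, M.gammaStar x p y = 0 :=
  sum_eq_zero_of_mem_rateVectors (hM.gammaStar_mem x p)

theorem diag_ge {x : Fin d} {a : Fin d → ℝ} (ha : a ∈ M.rateVectors x) : -(d * M.au) ≤ a x := by
  have h0 := hM.au_pos
  rw [ha.2, neg_le_neg_iff]
  calc ∑ y ∈ Finset.univ.erase x, a y ≤ ∑ y ∈ Finset.univ.erase x, M.au :=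
        Finset.sum_le_sum fun y hy => (ha.1 y (Finset.ne_of_mem_erase hy)).2
    _ ≤ ∑ _y : Fin d, M.au :=
        Finset.sum_le_sum_of_subset_of_nonneg (Finset.erase_subset _ _) fun _ _ _ => h0.le
    _ = _ := by simp

theorem abs_le_of_mem_rateVectors {x : Fin d} {a : Fin d → ℝ} (ha : a ∈ M.rateVectors x)
    (y : Fin d) : |a y| ≤ d * M.au := by
  have h0 := hM.au_pos
  have hal := hM.al_pos
  have hd : (1 : ℝ) ≤ d := by exact_mod_cast (Nat.pos_of_ne_zero fun h => by subst h; exact x.elim0)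
  by_cases hyx : y = x
  · subst hyx
    have h1 := hM.diag_ge ha
    have h2 : 0 ≤ ∑ z ∈ Finset.univ.erase y, a z :=
      Finset.sum_nonneg fun z hz => hal.le.trans (ha.1 z (Finset.ne_of_mem_erase hz)).1
    have h3 := ha.2
    rw [abs_le]
    constructor <;> nlinarith
  · have h1 := ha.1 y hyx
    rw [abs_of_nonneg (hal.le.trans h1.1)]
    nlinarith [h1.2]

theorem H_eq (x : Fin d) (p : Fin d → ℝ) :
    M.H x p = M.f x (M.gammaStar x p) + ∑ y, M.gammaStar x p y * p y := by
  have h := hM.isOptimalRate_gammaStar x p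
  refine IsLeast.csInf_eq ⟨⟨_, h.1, rfl⟩, ?_⟩
  rintro _ ⟨b, hb, rfl⟩
  exact h.2 b hb

theorem H_le {x : Fin d} {a : Fin d → ℝ} (ha : a ∈ M.rateVectors x) (p : Fin d → ℝ) :
    M.H x p ≤ M.f x a + ∑ y, a y * p y := by
  rw [hM.H_eq]
  exact (hM.isOptimalRate_gammaStar x p).2 a ha

theorem eq_gammaStar {x : Fin d} {a : Fin d → ℝ} (ha : a ∈ M.rateVectors x) {p : Fin d → ℝ}
    (h : M.f x a + ∑ y, a y * p y = M.H x p) : a = M.gammaStar x p := by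
  refine (hM.existsUnique_optimal x p).unique ⟨ha, fun b hb => ?_⟩ (hM.isOptimalRate_gammaStar x p)
  rw [h]
  exact hM.H_le hb p

/-- The optimizer at `p` is a competitor at `q`. This supergradient inequality is the source of the
envelope formula, of the Lipschitz bound and of monotonicity. -/
theorem H_le_add (x : Fin d) (p q : Fin d → ℝ) :
    M.H x q ≤ M.H x p + ∑ y, M.gammaStar x p y * (q y - p y) := by
  refine (hM.H_le (hM.gammaStar_mem x p) q).trans_eq ?_
  rw [hM.H_eq]
  simp only [mul_sub, Finset.sum_sub_distrib]
  ring

theorem hasFDerivAt_H (x : Fin d) (p : Fin d → ℝ) :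
    HasFDerivAt (M.H x) (fderiv ℝ (M.H x) p) p :=
  ((hM.H_contDiff x).differentiable (by norm_num) p).hasFDerivAt

theorem contDiff_fderiv_H (x : Fin d) : ContDiff ℝ 1 (fderiv ℝ (M.H x)) :=
  (hM.H_contDiff x).fderiv_right (by norm_num)

/-- Envelope formula: the optimal rate is the gradient of the Hamiltonian. -/
theorem fderiv_H (x : Fin d) (p v : Fin d → ℝ) :
    fderiv ℝ (M.H x) p v = ∑ y, M.gammaStar x p y * v y := by
  let g : (Fin d → ℝ) →L[ℝ] ℝ :=
    LinearMap.toContinuousLinearMap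
      { toFun := fun q => ∑ y, M.gammaStar x p y * q y
        map_add' := fun a b => by simp [mul_add, Finset.sum_add_distrib]
        map_smul' := fun c a => by simp [Finset.mul_sum, mul_left_comm] }
  -- By the supergradient inequality, `H` minus the linear form of the optimal rate is maximal at
  -- `p`.
  have hmax : IsLocalMax (fun q => M.H x q - g q) p := by
    refine Eventually.of_forall fun q => ?_
    have h := hM.H_le_add x p q
    simp only [mul_sub, Finset.sum_sub_distrib] at h
    change M.H x q - ∑ y, M.gammaStar x p y * q y ≤ M.H x p - ∑ y, M.gammaStar x p y * p y
    linarith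
  have h := hmax.hasFDerivAt_eq_zero ((hM.hasFDerivAt_H x p).sub g.hasFDerivAt)
  rw [sub_eq_zero.1 h]
  rfl

theorem gammaStar_eq_fderiv (x : Fin d) (p : Fin d → ℝ) (y : Fin d) :
    M.gammaStar x p y = fderiv ℝ (M.H x) p (Pi.single y 1) := by
  rw [hM.fderiv_H]
  simp [Pi.single_apply]

theorem continuous_gammaStar (x y : Fin d) : Continuous fun p => M.gammaStar x p y := by
  simp_rw [hM.gammaStar_eq_fderiv]
  exact (hM.contDiff_fderiv_H x).continuous.clm_apply continuous_const

theorem continuous_H (x : Fin d) : Continuous (M.H x) := (hM.H_contDiff x).continuous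

/-- By the envelope formula this is the Lipschitz assumption on `D_p H`; summing the constants makes
the bound uniform in `x`. -/
theorem exists_gammaStar_lipschitz {K : ℝ} (hK : 0 < K) : ∃ L : ℝ, 0 ≤ L ∧ ∀ x (p q : Fin d → ℝ),
    (∀ y, |p y| ≤ K) → (∀ y, |q y| ≤ K) →
      ∀ y, |M.gammaStar x p y - M.gammaStar x q y| ≤ L * ‖p - q‖ := by
  choose L hL using fun x => (hM.H_lipschitz x K hK).1
  refine ⟨∑ x, (L x : ℝ), by positivity, fun x p q hp hq y => ?_⟩
  have h := (hL x).norm_sub_le (mem_box_iff.2 hp) (mem_box_iff.2 hq)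
  rw [hM.gammaStar_eq_fderiv, hM.gammaStar_eq_fderiv, ← _root_.sub_apply,
    ← Real.norm_eq_abs]
  refine (ContinuousLinearMap.le_opNorm _ _).trans ?_
  have h1 : ‖(Pi.single y 1 : Fin d → ℝ)‖ = 1 := by rw [Pi.norm_single, norm_one]
  rw [h1, mul_one]
  refine h.trans ?_
  gcongr
  exact Finset.single_le_sum (f := fun x => (L x : ℝ)) (fun _ _ => NNReal.coe_nonneg _)
    (Finset.mem_univ x)

/-- Valid on the whole space, not just on boxes, because the supergradients are rate vectors, with
entries bounded by `d * au`. -/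
theorem abs_H_sub_le (x : Fin d) (p q : Fin d → ℝ) :
    |M.H x p - M.H x q| ≤ d * (d * M.au) * ‖p - q‖ := by
  have h : ∀ p q : Fin d → ℝ, M.H x p - M.H x q ≤ d * (d * M.au) * ‖p - q‖ := by
    intro p q
    have h1 := hM.H_le_add x q p
    have h2 := abs_sum_mul_le _ (p - q) (hM.abs_le_of_mem_rateVectors (hM.gammaStar_mem x q))
    have h3 := (le_abs_self _).trans h2
    simp only [Pi.sub_apply] at h3
    linarith
  rw [abs_le]
  have h1 := h p q
  have h2 := h q p
  rw [norm_sub_rev] at h2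
  constructor <;> linarith

/-- For use where a potential is maximal, so that its difference vector has this sign. All rates
away from `x` are at least `al`, hence each negative entry lowers `H` by at least `al` times its
size. `H_ge_of_nonneg` is the counterpart at a minimum. -/
theorem H_le_of_nonpos {x : Fin d} {p : Fin d → ℝ} (hp : ∀ y, p y ≤ 0) (hx : p x = 0) (y : Fin d) :
    M.H x p ≤ M.H x 0 + M.al * p y := by
  refine (hM.H_le_add x 0 p).trans ?_
  simp only [Pi.zero_apply, sub_zero]
  have hm := hM.gammaStar_mem x 0
  gcongr
  have hal := hM.al_pos
  have hle : ∀ z, M.gammaStar x 0 z * p z ≤ M.al * p z := by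
    intro z
    by_cases hz : z = x
    · subst hz; simp [hx]
    · nlinarith [(hm.1 z hz).1, hp z]
  calc ∑ z, M.gammaStar x 0 z * p z ≤ ∑ z, M.al * p z := Finset.sum_le_sum fun z _ => hle z
    _ = -∑ z, M.al * -p z := by simp
    _ ≤ _ := by
      have := Finset.single_le_sum (f := fun z => M.al * -p z)
        (fun z _ => mul_nonneg hal.le (neg_nonneg.2 (hp z))) (Finset.mem_univ y)
      linarith

theorem sum_gammaStar_mul_le (x : Fin d) (p : Fin d → ℝ) :
    ∑ y, M.gammaStar x p y * p y ≤ M.H x p - M.H x 0 := by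
  have h := hM.H_le_add x p 0
  simp only [Pi.zero_apply, zero_sub, mul_neg, Finset.sum_neg_distrib] at h
  linarith

theorem H_ge_of_nonneg {x : Fin d} {p : Fin d → ℝ} (hp : ∀ y, 0 ≤ p y) (hx : p x = 0) (y : Fin d) :
    M.H x 0 + M.al * p y ≤ M.H x p := by
  have h := hM.sum_gammaStar_mul_le x p
  have hm := hM.gammaStar_mem x p
  have hal := hM.al_pos
  have hle : ∀ z, M.al * p z ≤ M.gammaStar x p z * p z := by
    intro z
    by_cases hz : z = x
    · subst hz; simp [hx]
    · nlinarith [(hm.1 z hz).1, hp z]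
  have := Finset.single_le_sum (f := fun z => M.al * p z)
    (fun z _ => mul_nonneg hal.le (hp z)) (Finset.mem_univ y)
  have h2 := Finset.sum_le_sum (s := Finset.univ) fun z _ => hle z
  linarith

/-- Strong concavity of the Hamiltonian on boxes. -/
theorem exists_strongly_concave {K : ℝ} (hK : 0 < K) : ∃ c : ℝ, 0 < c ∧ ∀ x (p q : Fin d → ℝ),
    (∀ y, |p y| ≤ K) → (∀ y, |q y| ≤ K) → p x = q x →
      M.H x q ≤ M.H x p + ∑ y, M.gammaStar x p y * (q y - p y) - c * eucl (q - p) ^ 2 := by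
  obtain ⟨C, hC, hconc⟩ := hM.H_concave K hK
  refine ⟨C / 2, by positivity, fun x p q hp hq hpq => ?_⟩
  set v := q - p with hv
  set E := eucl v ^ 2 with hE
  have hvx : v x = 0 := by simp [hv, hpq]
  have hline : ∀ t : ℝ, HasDerivAt (fun t : ℝ => p + t • v) v t := fun t => by
    simpa using ((hasDerivAt_id t).smul_const v).const_add p
  have hbox : ∀ t ∈ Set.Icc (0 : ℝ) 1, p + t • v ∈ Set.Icc (fun _ : Fin d => -K) (fun _ => K) := by
    intro t ht
    have := (convex_Icc (fun _ : Fin d => -K) (fun _ => K)).add_smul_sub_mem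
      (mem_box_iff.2 hp) (mem_box_iff.2 hq) ht
    simpa [hv] using this
  have hd1 : ∀ t : ℝ, HasDerivAt (fun t : ℝ => M.H x (p + t • v)) (fderiv ℝ (M.H x) (p + t • v) v) t :=
    fun t => by
      have h := (hM.hasFDerivAt_H x (p + t • v)).comp_hasDerivAt t (hline t)
      exact h
  have hd2 : ∀ t : ℝ, HasDerivAt (fun t : ℝ => fderiv ℝ (M.H x) (p + t • v) v)
      (fderiv ℝ (fderiv ℝ (M.H x)) (p + t • v) v v) t := by
    intro t
    have h := ((hM.contDiff_fderiv_H x).differentiable (by norm_num) (p + t • v)).hasFDerivAt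
      |>.comp_hasDerivAt t (hline t)
    simpa using h.clm_apply (hasDerivAt_const t v)
  have hd2' : ∀ t : ℝ, HasDerivAt (fun t : ℝ => fderiv ℝ (M.H x) (p + t • v) v + C * E * t)
      (fderiv ℝ (fderiv ℝ (M.H x)) (p + t • v) v v + C * E) t := fun t => by
    simpa using (hd2 t).fun_add ((hasDerivAt_id' t).const_mul (C * E))
  -- The bound on the second derivative along the segment is integrated twice, in the form of two
  -- monotonicity statements; this produces the factor `C / 2`.
  have hanti : AntitoneOn (fun t : ℝ => fderiv ℝ (M.H x) (p + t • v) v + C * E * t)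
      (Set.Icc 0 1) := by
    refine antitoneOn_of_deriv_nonpos (convex_Icc 0 1)
      (fun t _ => (hd2' t).continuousAt.continuousWithinAt)
      (fun t _ => (hd2' t).differentiableAt.differentiableWithinAt) fun t ht => ?_
    rw [interior_Icc] at ht
    rw [(hd2' t).deriv]
    have := hconc x _ (hbox t (Set.Ioo_subset_Icc_self ht)) v hvx
    linarith
  set A := fderiv ℝ (M.H x) p v with hA
  have hd1' : ∀ t : ℝ, HasDerivAt (fun t : ℝ => M.H x (p + t • v) - A * t + C / 2 * E * t ^ 2)
      (fderiv ℝ (M.H x) (p + t • v) v - A + C * E * t) t := fun t => by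
    have h := ((hd1 t).fun_sub ((hasDerivAt_id' t).const_mul A)).fun_add
      (((hasDerivAt_id' t).fun_pow 2).const_mul (C / 2 * E))
    refine h.congr_deriv ?_
    push_cast; ring
  have hanti2 : AntitoneOn (fun t : ℝ => M.H x (p + t • v) - A * t + C / 2 * E * t ^ 2)
      (Set.Icc 0 1) := by
    refine antitoneOn_of_deriv_nonpos (convex_Icc 0 1)
      (fun t _ => (hd1' t).continuousAt.continuousWithinAt)
      (fun t _ => (hd1' t).differentiableAt.differentiableWithinAt) fun t ht => ?_
    rw [interior_Icc] at ht
    rw [(hd1' t).deriv]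
    have := hanti (Set.left_mem_Icc.2 zero_le_one) (Set.Ioo_subset_Icc_self ht) ht.1.le
    simp only [zero_smul, add_zero, mul_zero] at this
    linarith
  have h := hanti2 (Set.left_mem_Icc.2 zero_le_one) (Set.right_mem_Icc.2 zero_le_one) zero_le_one
  have hq' : p + v = q := by simp [hv]
  simp only [one_smul, hq', zero_smul, add_zero] at h
  rw [hA, hM.fderiv_H] at h
  simp only [hv, Pi.sub_apply] at h ⊢
  linarith

end Assumptions

end Data

/-! ### Lipschitz continuity from directional derivatives on the simplex. -/

theorem edge_apply (y z x : Fin d) :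
    edge y z x = (if x = z then 1 else 0) - (if x = y then 1 else 0) := by
  simp [edge, Pi.single_apply]

theorem edge_swap (y z : Fin d) : edge z y = -edge y z := by
  simp [edge]

theorem add_smul_edge_mem {η : Fin d → ℝ} (hη : η ∈ stdSimplex ℝ (Fin d)) {y z : Fin d}
    (hyz : y ≠ z) {t : ℝ} (ht0 : 0 ≤ t) (ht : t ≤ η y) :
    η + t • edge y z ∈ stdSimplex ℝ (Fin d) := by
  refine ⟨fun x => ?_, ?_⟩
  · have := hη.1 x
    simp only [Pi.add_apply, Pi.smul_apply, smul_eq_mul, edge_apply]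
    by_cases h1 : x = z
    · simp [h1, hyz.symm]; rw [← h1]; linarith
    · by_cases h2 : x = y
      · subst h2; simp [h1]; linarith
      · simp [h1, h2]; linarith
  · simp [Finset.sum_add_distrib, hη.2, edge_apply, ← Finset.mul_sum, Finset.sum_sub_distrib]

/-- Moving the mass `T` along an edge changes `K` by at most `B * T`. -/
theorem HasSimplexDeriv.abs_sub_edge_le {K : (Fin d → ℝ) → ℝ} {D : (Fin d → ℝ) → Fin d → Fin d → ℝ}
    (hD : HasSimplexDeriv K D) {B : ℝ} (hB : ∀ η ∈ stdSimplex ℝ (Fin d), ∀ y z, |D η y z| ≤ B)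
    {η : Fin d → ℝ} (hη : η ∈ stdSimplex ℝ (Fin d)) {y z : Fin d} (hyz : y ≠ z) {T : ℝ}
    (hT0 : 0 ≤ T) (hT : T ≤ η y) : |K (η + T • edge y z) - K η| ≤ B * T := by
  set p : ℝ → Fin d → ℝ := fun t => η + t • edge y z with hp
  have hpmem : ∀ t ∈ Set.Icc 0 T, p t ∈ stdSimplex ℝ (Fin d) := fun t ht =>
    add_smul_edge_mem hη hyz ht.1 (ht.2.trans hT)
  have hpy : ∀ t, p t y = η y - t := fun t => by simp [hp, edge_apply, hyz]; ring
  have hpz : ∀ t, p t z = η z + t := fun t => by simp [hp, edge_apply, hyz.symm]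
  have hpadd : ∀ t h, p t + h • edge y z = p (t + h) := fun t h => by
    simp only [hp, add_smul, add_assoc]
  have hpsub : ∀ t h, p t + h • edge z y = p (t - h) := fun t h => by
    simp only [hp, edge_swap y z, sub_smul, smul_neg]; abel
  have hright : ∀ t ∈ Set.Ico 0 T,
      HasDerivWithinAt (fun t => K (p t)) (D (p t) y z) (Set.Ici t) t := by
    intro t ht
    have h := hD (p t) (hpmem t (Set.Ico_subset_Icc_self ht)) y z hyz
      (by rw [hpy]; linarith [ht.2])
    simp_rw [hpadd] at h
    rw [← hasDerivWithinAt_Ioi_iff_Ici, hasDerivWithinAt_iff_tendsto_slope' (by simp)]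
    have hsub : Tendsto (fun s => s - t) (𝓝[>] t) (𝓝[>] 0) := by
      refine tendsto_nhdsWithin_iff.2 ⟨?_, ?_⟩
      · have : Tendsto (fun s => s - t) (𝓝 t) (𝓝 (t - t)) := tendsto_id.sub_const t
        rw [sub_self] at this
        exact this.mono_left nhdsWithin_le_nhds
      · filter_upwards [self_mem_nhdsWithin] with s hs
        exact sub_pos.2 (Set.mem_Ioi.1 hs)
    refine (h.comp hsub).congr fun s => ?_
    simp only [Function.comp, slope_def_field, add_sub_cancel]
  -- The mean value inequality needs only right derivatives, but also continuity. Left continuity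
  -- comes from the derivative along the reversed edge, available for `t > 0` because `z` then
  -- carries mass.
  have hleft : ∀ t ∈ Set.Ioc 0 T, ContinuousWithinAt (fun t => K (p t)) (Set.Iic t) t := by
    intro t ht
    have h := hD (p t) (hpmem t (Set.Ioc_subset_Icc_self ht)) z y hyz.symm
      (by rw [hpz]; linarith [ht.1, hη.1 z])
    simp_rw [hpsub] at h
    rw [← continuousWithinAt_Iio_iff_Iic]
    have hsub : Tendsto (fun s => t - s) (𝓝[<] t) (𝓝[>] 0) := by
      refine tendsto_nhdsWithin_iff.2 ⟨?_, ?_⟩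
      · have : Tendsto (fun s => t - s) (𝓝 t) (𝓝 (t - t)) := tendsto_id.const_sub t
        rw [sub_self] at this
        exact this.mono_left nhdsWithin_le_nhds
      · filter_upwards [self_mem_nhdsWithin] with s hs
        exact sub_pos.2 (Set.mem_Iio.1 hs)
    have h2 : Tendsto (fun s => t - s) (𝓝[<] t) (𝓝 0) := hsub.mono_right nhdsWithin_le_nhds
    have h3 := ((h.comp hsub).mul h2).add_const (K (p t))
    rw [mul_zero, zero_add] at h3
    refine h3.congr' ?_
    filter_upwards [self_mem_nhdsWithin] with s hs
    have : t - s ≠ 0 := (sub_pos.2 (Set.mem_Iio.1 hs)).ne'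
    simp only [Function.comp, sub_sub_cancel]
    rw [div_mul_cancel₀ _ this, sub_add_cancel]
  have hcont : ContinuousOn (fun t => K (p t)) (Set.Icc 0 T) := by
    intro t ht
    rcases eq_or_lt_of_le ht.1 with h0 | h0
    · rcases eq_or_lt_of_le ht.2 with h1 | h1
      · have : Set.Icc 0 T = {t} := by rw [← h1, ← h0]; simp
        rw [this]; exact continuousWithinAt_singleton
      · exact (hright t ⟨ht.1, h1⟩).continuousWithinAt.mono fun s hs => h0 ▸ hs.1
    · have hl := hleft t ⟨h0, ht.2⟩
      rcases eq_or_lt_of_le ht.2 with h1 | h1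
      · exact hl.mono fun s hs => h1 ▸ hs.2
      · exact (continuousAt_iff_continuous_left_right.2
          ⟨hl, (hright t ⟨ht.1, h1⟩).continuousWithinAt⟩).continuousWithinAt
  have := norm_image_sub_le_of_norm_deriv_right_le_segment hcont hright
    (fun t ht => hB _ (hpmem t (Set.Ico_subset_Icc_self ht)) y z) T (Set.right_mem_Icc.2 hT0)
  simpa [hp] using this

/-- Mass is moved from a state `y` with excess to a state `z` with deficit, as much as possible.
Each move makes `η` and `η'` agree at one more state, whence the induction on the number of
disagreements. Moving `T` costs at most `B * T` and shortens the ℓ¹ distance by `2 * T`. -/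
theorem HasSimplexDeriv.abs_sub_le {K : (Fin d → ℝ) → ℝ} {D : (Fin d → ℝ) → Fin d → Fin d → ℝ}
    (hD : HasSimplexDeriv K D) {B : ℝ} (hB0 : 0 ≤ B)
    (hB : ∀ η ∈ stdSimplex ℝ (Fin d), ∀ y z, |D η y z| ≤ B)
    {η η' : Fin d → ℝ} (hη : η ∈ stdSimplex ℝ (Fin d)) (hη' : η' ∈ stdSimplex ℝ (Fin d)) :
    |K η - K η'| ≤ B * ∑ x, |η x - η' x| := by
  induction hn : (Finset.univ.filter fun x => η x ≠ η' x).card using Nat.strong_induction_on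
    generalizing η with
  | _ n ih =>
  by_cases heq : η = η'
  · subst heq; simp
  have hsum : ∑ x, (η x - η' x) = 0 := by rw [Finset.sum_sub_distrib, hη.2, hη'.2, sub_self]
  obtain ⟨x, hx⟩ := Function.ne_iff.1 heq
  have hne : ∃ x ∈ Finset.univ, η x - η' x ≠ 0 := ⟨x, Finset.mem_univ x, sub_ne_zero.2 hx⟩
  obtain ⟨y, -, hy⟩ := Finset.exists_pos_of_sum_zero_of_exists_nonzero _ hsum hne
  obtain ⟨z, -, hz⟩ := Finset.exists_pos_of_sum_zero_of_exists_nonzero (s := Finset.univ)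
    (fun x => η' x - η x) (by rw [Finset.sum_sub_distrib, hη.2, hη'.2, sub_self])
    ⟨x, Finset.mem_univ x, sub_ne_zero.2 (Ne.symm hx)⟩
  have hyz : y ≠ z := by rintro rfl; linarith
  set T := min (η y - η' y) (η' z - η z) with hT
  have hTy : T ≤ η y - η' y := min_le_left _ _
  have hTz : T ≤ η' z - η z := min_le_right _ _
  have hT0 : 0 ≤ T := le_min hy.le hz.le
  have hTy' : T ≤ η y := by linarith [hη'.1 y]
  set η₁ := η + T • edge y z with hη₁
  have hmem := add_smul_edge_mem hη hyz hT0 hTy'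
  have h1y : η₁ y = η y - T := by simp [hη₁, edge_apply, hyz]; ring
  have h1z : η₁ z = η z + T := by simp [hη₁, edge_apply, hyz.symm]
  have h1x : ∀ x, x ≠ y → x ≠ z → η₁ x = η x := fun x hxy hxz => by simp [hη₁, edge_apply, hxy, hxz]
  have hcard : (Finset.univ.filter fun x => η₁ x ≠ η' x).card < n := by
    rw [← hn]
    refine Finset.card_lt_card ((Finset.ssubset_iff_of_subset fun x hx => ?_).2 ?_)
    · simp only [Finset.mem_filter, Finset.mem_univ, true_and] at hx ⊢
      by_cases hxy : x = y
      · subst hxy; linarith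
      · by_cases hxz : x = z
        · subst hxz; intro h; linarith
        · rwa [h1x x hxy hxz] at hx
    · rcases min_choice (η y - η' y) (η' z - η z) with h | h
      · refine ⟨y, by simp; intro h; linarith, ?_⟩
        simp [h1y, hT, h]
      · refine ⟨z, by simp; intro h; linarith, ?_⟩
        simp [h1z, hT, h]
  have hIH := ih _ hcard hmem rfl
  have hmove := hD.abs_sub_edge_le hB hη hyz hT0 hTy'
  have hL1 : ∑ x, |η₁ x - η' x| = ∑ x, |η x - η' x| - 2 * T := by
    have : ∀ x, |η₁ x - η' x| =
        |η x - η' x| - ((if x = y then T else 0) + if x = z then T else 0) := by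
      intro x
      by_cases hxy : x = y
      · subst hxy
        simp only [hyz, if_true, if_false, h1y]
        rw [abs_of_nonneg (by linarith), abs_of_nonneg (by linarith)]; ring
      · by_cases hxz : x = z
        · subst hxz
          simp only [hxy, if_true, if_false, h1z]
          rw [abs_of_nonpos (by linarith), abs_of_nonpos (by linarith)]; ring
        · simp [hxy, hxz, h1x x hxy hxz]
    simp_rw [this]
    rw [Finset.sum_sub_distrib, Finset.sum_add_distrib]
    simp; ring
  rw [hL1] at hIH
  rw [abs_sub_comm] at hmove
  calc |K η - K η'| ≤ |K η - K η₁| + |K η₁ - K η'| := _root_.abs_sub_le _ _ _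
    _ ≤ B * T + B * (∑ x, |η x - η' x| - 2 * T) := add_le_add hmove hIH
    _ ≤ _ := by nlinarith

theorem sum_abs_sub_le (η η' : Fin d → ℝ) : ∑ x, |η x - η' x| ≤ d * ‖η - η'‖ := by
  calc ∑ x, |η x - η' x| ≤ ∑ _x : Fin d, ‖η - η'‖ :=
        Finset.sum_le_sum fun x _ => norm_le_pi_norm (η - η') x
    _ = _ := by simp

namespace Data.Assumptions

variable {M : Data d} (hM : M.Assumptions)
include hM

/-- The derivative is continuous on the compact simplex, hence bounded. -/
theorem exists_F_lipschitz : ∃ L : ℝ, 0 ≤ L ∧ ∀ x, ∀ η ∈ stdSimplex ℝ (Fin d),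
    ∀ η' ∈ stdSimplex ℝ (Fin d), |M.F x η - M.F x η'| ≤ L * ∑ y, |η y - η' y| := by
  have h : ∀ x, ∃ L : ℝ, 0 ≤ L ∧ ∀ η ∈ stdSimplex ℝ (Fin d),
      ∀ η' ∈ stdSimplex ℝ (Fin d), |M.F x η - M.F x η'| ≤ L * ∑ y, |η y - η' y| := by
    intro x
    obtain ⟨D, hD, hcont, -⟩ := hM.F_regular x
    obtain ⟨B, hB⟩ := (isCompact_stdSimplex ℝ (Fin d)).exists_bound_of_continuousOn hcont
    refine ⟨|B|, abs_nonneg _, fun η hη η' hη' => hD.abs_sub_le (abs_nonneg _) ?_ hη hη'⟩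
    intro η hη y z
    exact ((norm_le_pi_norm (D η y) z).trans (norm_le_pi_norm (D η) y)).trans
      ((hB η hη).trans (le_abs_self _))
  choose L hL0 hL using h
  refine ⟨∑ x, L x, Finset.sum_nonneg fun x _ => hL0 x, fun x η hη η' hη' => ?_⟩
  refine (hL x η hη η' hη').trans ?_
  refine mul_le_mul_of_nonneg_right ?_ (Finset.sum_nonneg fun _ _ => abs_nonneg _)
  exact Finset.single_le_sum (f := L) (fun x _ => hL0 x) (Finset.mem_univ x)

theorem continuousOn_F (x : Fin d) : ContinuousOn (M.F x) (stdSimplex ℝ (Fin d)) := by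
  obtain ⟨L, hL0, hL⟩ := hM.exists_F_lipschitz
  have : LipschitzOnWith (L * d).toNNReal (M.F x) (stdSimplex ℝ (Fin d)) := by
    refine LipschitzOnWith.of_dist_le_mul fun η hη η' hη' => ?_
    rw [Real.coe_toNNReal _ (by positivity), Real.dist_eq, dist_eq_norm, mul_assoc]
    exact (hL x η hη η' hη').trans (mul_le_mul_of_nonneg_left (sum_abs_sub_le η η') hL0)
  exact this.continuousOn

theorem exists_F_bound : ∃ B : ℝ, 0 ≤ B ∧ ∀ x, ∀ η ∈ stdSimplex ℝ (Fin d), |M.F x η| ≤ B := by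
  choose B hB using fun x =>
    (isCompact_stdSimplex ℝ (Fin d)).exists_bound_of_continuousOn (hM.continuousOn_F x)
  refine ⟨∑ x, |B x|, by positivity, fun x η hη => ((hB x η hη).trans (le_abs_self _)).trans ?_⟩
  exact Finset.single_le_sum (f := fun x => |B x|) (fun x _ => abs_nonneg _) (Finset.mem_univ x)

end Data.Assumptions

/-! ### Matrix games and monotone variational inequalities. -/

/-- A matrix game whose symmetric part is nonnegative has a nonnegative value. -/
theorem exists_stdSimplex_forall_sum_nonneg {ι : Type*} [Fintype ι] [Nonempty ι] (a : ι → ι → ℝ)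
    (ha : ∀ i j, 0 ≤ a i j + a j i) :
    ∃ c ∈ stdSimplex ℝ ι, ∀ i, 0 ≤ ∑ j, c j * a i j := by
  classical
  by_contra! hcon
  set S : Set (ι → ℝ) := (fun c : ι → ℝ => fun i => ∑ j, c j * a i j) '' stdSimplex ℝ ι
  have hSc : IsCompact S := (isCompact_stdSimplex ℝ ι).image (by fun_prop)
  have hSconv : Convex ℝ S := by
    let g : (ι → ℝ) →ₗ[ℝ] (ι → ℝ) :=
      { toFun := fun c i => ∑ j, c j * a i j
        map_add' := fun x y => by ext i; simp [add_mul, Finset.sum_add_distrib]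
        map_smul' := fun t x => by ext i; simp [Finset.mul_sum, mul_assoc] }
    exact (convex_stdSimplex ℝ ι).linear_image g
  have hQ : Convex ℝ (Set.Ici (0 : ι → ℝ)) := convex_Ici 0
  have hdisj : Disjoint S (Set.Ici (0 : ι → ℝ)) := by
    rw [Set.disjoint_left]
    rintro _ ⟨c, hc, rfl⟩ h
    obtain ⟨i, hi⟩ := hcon c hc
    exact absurd (h i) (not_le.2 hi)
  -- If the payoff set missed the orthant, a separating functional would have nonnegative weights
  -- `w`, not all zero, with `∑ i, a i j * w i < 0` for every `j`. Averaging over `j` with the same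
  -- weights contradicts the sign of the symmetric part.
  obtain ⟨f, u, v, hfu, huv, hfv⟩ :=
    geometric_hahn_banach_compact_closed hSconv hSc hQ isClosed_Ici hdisj
  set w : ι → ℝ := fun i => f (Pi.single i 1) with hw
  have hf : ∀ z : ι → ℝ, f z = ∑ i, z i * w i := by
    intro z
    have hz : z = ∑ i, z i • (Pi.single i 1 : ι → ℝ) := by
      ext j
      simp [Pi.single_apply]
    conv_lhs => rw [hz]
    simp [map_sum, hw]
  have hv0 : v < 0 := by simpa using hfv 0 (Set.mem_Ici.2 le_rfl)
  have hw0 : ∀ i, 0 ≤ w i := by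
    intro i
    by_contra! hi
    have h := hfv ((v / w i) • Pi.single i 1) (by
      rw [Set.mem_Ici]
      refine smul_nonneg (div_nonneg_of_nonpos hv0.le hi.le) ?_
      rw [Pi.single_nonneg]; exact zero_le_one)
    rw [map_smul, smul_eq_mul] at h
    change v < v / w i * w i at h
    rw [div_mul_cancel₀ _ hi.ne] at h
    exact lt_irrefl _ h
  have hneg : ∀ j, ∑ i, a i j * w i < 0 := by
    intro j
    have h := hfu _ ⟨Pi.single j 1, single_mem_stdSimplex ℝ j, rfl⟩
    rw [hf] at h
    simp [Pi.single_apply] at h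
    linarith
  have hwne : ∃ j, 0 < w j := by
    by_contra! h
    obtain ⟨j⟩ := ‹Nonempty ι›
    have h2 := hneg j
    rw [Finset.sum_eq_zero fun i _ => by rw [le_antisymm (h i) (hw0 i), mul_zero]] at h2
    exact lt_irrefl _ h2
  obtain ⟨j₀, hj₀⟩ := hwne
  have h1 : ∑ j, w j * ∑ i, a i j * w i < 0 :=
    Finset.sum_neg' (fun j _ => mul_nonpos_of_nonneg_of_nonpos (hw0 j) (hneg j).le)
      ⟨j₀, Finset.mem_univ _, mul_neg_of_pos_of_neg hj₀ (hneg j₀)⟩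
  have h2 : 0 ≤ ∑ j, ∑ i, w j * w i * (a i j + a j i) :=
    Finset.sum_nonneg fun j _ => Finset.sum_nonneg fun i _ =>
      mul_nonneg (mul_nonneg (hw0 j) (hw0 i)) (ha i j)
  have h3 : ∑ j, ∑ i, w j * w i * (a i j + a j i) = 2 * ∑ j, w j * ∑ i, a i j * w i := by
    have e1 : ∑ j, ∑ i, w j * w i * a i j = ∑ j, w j * ∑ i, a i j * w i := by
      refine Finset.sum_congr rfl fun j _ => ?_
      rw [Finset.mul_sum]
      exact Finset.sum_congr rfl fun i _ => by ring
    have e2 : ∑ j, ∑ i, w j * w i * a j i = ∑ j, ∑ i, w j * w i * a i j := by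
      rw [Finset.sum_comm]
      exact Finset.sum_congr rfl fun i _ => Finset.sum_congr rfl fun j _ => by ring
    simp only [mul_add, Finset.sum_add_distrib]
    rw [e2, e1]; ring
  linarith

/-- Solvability of the variational inequality for a continuous monotone operator on a compact convex
set. -/
theorem exists_variational_inequality {E : Type*} [NormedAddCommGroup E] [NormedSpace ℝ E]
    {S : Set E} (hS : IsCompact S) (hconv : Convex ℝ S) (hne : S.Nonempty) (B : E → E →L[ℝ] ℝ)
    (hB : ∀ v, ContinuousOn (fun z => B z v) S)
    (hmono : ∀ z ∈ S, ∀ w ∈ S, 0 ≤ B z (z - w) - B w (z - w)) :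
    ∃ z ∈ S, ∀ w ∈ S, 0 ≤ B z (w - z) := by
  classical
  -- the weak form of the inequality
  obtain ⟨z, hzS, hz⟩ : ∃ z ∈ S, ∀ w ∈ S, 0 ≤ B w (w - z) := by
    -- Finite intersection property. For finitely many test points the game with payoff `B i (i -
    -- j)` has nonnegative symmetric part by monotonicity, and an optimal mixed strategy is a convex
    -- combination satisfying all the inequalities.
    have h := hS.inter_iInter_nonempty (fun w : S => {z | 0 ≤ B w (w - z)})
      (fun w => isClosed_le continuous_const ((B w).continuous.comp (continuous_const.sub continuous_id)))
      fun u => by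
        rcases u.eq_empty_or_nonempty with rfl | hu
        · simpa using hne
        have : Nonempty u := hu.to_subtype
        obtain ⟨c, hc, hc2⟩ := exists_stdSimplex_forall_sum_nonneg
          (fun i j : u => B (i : S) ((i : S) - (j : S) : E)) fun i j => by
            have h := hmono _ (i : S).2 _ (j : S).2
            rw [← neg_sub (j : S).1 (i : S).1, map_neg, map_neg] at h
            rw [← neg_sub (j : S).1 (i : S).1, map_neg]
            linarith
        refine ⟨∑ j, c j • ((j : S) : E),
          hconv.sum_mem (fun j _ => hc.1 j) hc.2 fun j _ => (j : S).2, ?_⟩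
        simp only [Set.mem_iInter]
        intro i hi
        have h := hc2 ⟨i, hi⟩
        have e : (i : E) - ∑ j, c j • ((j : S) : E) = ∑ j, c j • ((i : E) - ((j : S) : E)) := by
          simp only [smul_sub, Finset.sum_sub_distrib, ← Finset.sum_smul]
          rw [hc.2, one_smul]
        change 0 ≤ B i ((i : E) - ∑ j, c j • ((j : S) : E))
        rw [e, map_sum]
        simpa using h
    obtain ⟨z, hzS, hz⟩ := h
    rw [Set.mem_iInter] at hz
    exact ⟨z, hzS, fun w hw => hz ⟨w, hw⟩⟩
  refine ⟨z, hzS, fun w hw => ?_⟩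
  -- Minty's trick: the weak inequality is tested along the segment towards `w`, divided by `t`, and
  -- passed to the limit `t → 0`.
  have hpath : ∀ t ∈ Set.Ioc (0 : ℝ) 1, 0 ≤ B (z + t • (w - z)) (w - z) := by
    intro t ht
    have hm : z + t • (w - z) ∈ S := hconv.add_smul_sub_mem hzS hw ⟨ht.1.le, ht.2⟩
    have h := hz _ hm
    rw [add_sub_cancel_left, map_smul, smul_eq_mul] at h
    exact nonneg_of_mul_nonneg_right h ht.1
  have hlim : Tendsto (fun t : ℝ => B (z + t • (w - z)) (w - z)) (𝓝[>] 0) (𝓝 (B z (w - z))) := by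
    have h1 : Tendsto (fun t : ℝ => z + t • (w - z)) (𝓝[>] 0) (𝓝[S] z) := by
      refine tendsto_nhdsWithin_iff.2 ⟨?_, ?_⟩
      · have : Tendsto (fun t : ℝ => z + t • (w - z)) (𝓝 0) (𝓝 (z + (0 : ℝ) • (w - z))) :=
          Continuous.tendsto (by fun_prop) 0
        rw [zero_smul, add_zero] at this
        exact this.mono_left nhdsWithin_le_nhds
      · filter_upwards [Ioc_mem_nhdsGT zero_lt_one] with t ht
        exact hconv.add_smul_sub_mem hzS hw ⟨ht.1.le, ht.2⟩
    exact (hB (w - z) z hzS).tendsto.comp h1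
  refine ge_of_tendsto hlim ?_
  filter_upwards [Ioc_mem_nhdsGT zero_lt_one] with t ht using hpath t ht

/-! ### The ergodic system: a priori bounds, stability and existence. -/

theorem diffNorm_sq (p : Fin d → ℝ) : diffNorm p ^ 2 = ∑ x, eucl (diff x p) ^ 2 :=
  Real.sq_sqrt (Finset.sum_nonneg fun _ _ => sq_nonneg _)

theorem diffNorm_nonneg (p : Fin d → ℝ) : 0 ≤ diffNorm p := Real.sqrt_nonneg _

theorem norm_diff_le_diffNorm (x : Fin d) (p : Fin d → ℝ) : ‖diff x p‖ ≤ diffNorm p := by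
  refine (norm_le_eucl _).trans (Real.le_sqrt_of_sq_le ?_)
  exact Finset.single_le_sum (f := fun x => eucl (diff x p) ^ 2) (fun _ _ => sq_nonneg _)
    (Finset.mem_univ x)

/-- A vector of mean zero is bounded by its oscillation. -/
theorem abs_le_of_sum_eq_zero {u : Fin d → ℝ} (hu : ∑ x, u x = 0) {K : ℝ}
    (h : ∀ x y, |u x - u y| ≤ K) (x : Fin d) : |u x| ≤ K := by
  have hd : (0 : ℝ) < d := by exact_mod_cast (Nat.pos_of_ne_zero fun h => by subst h; exact x.elim0)
  have h1 : d * u x = ∑ y, (u x - u y) := by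
    rw [Finset.sum_sub_distrib, hu]; simp
  have h2 : d * |u x| ≤ d * K := by
    calc d * |u x| = |d * u x| := by rw [abs_mul, abs_of_pos hd]
      _ ≤ ∑ y, |u x - u y| := by rw [h1]; exact Finset.abs_sum_le_sum_abs _ _
      _ ≤ ∑ _y : Fin d, K := Finset.sum_le_sum fun y _ => h x y
      _ = _ := by simp
  exact le_of_mul_le_mul_left h2 hd

theorem norm_le_diffNorm {u : Fin d → ℝ} (hu : ∑ x, u x = 0) : ‖u‖ ≤ diffNorm u := by
  refine (pi_norm_le_iff_of_nonneg (diffNorm_nonneg _)).2 fun x => ?_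
  exact abs_le_of_sum_eq_zero hu
    (fun x y => (norm_le_pi_norm (diff y u) x).trans (norm_diff_le_diffNorm y u)) x

namespace Data

variable (M : Data d)

/-- The ergodic system in which the mean field cost is frozen to the vector `φ`. -/
structure IsErgodicTriple (φ : Fin d → ℝ) (ϱ : ℝ) (u μ : Fin d → ℝ) : Prop where
  sum_eq_zero : ∑ x, u x = 0
  mem : μ ∈ stdSimplex ℝ (Fin d)
  hamiltonJacobi : ∀ x, M.H x (diff x u) + φ x = ϱ
  stationary : ∀ x, ∑ y, μ y * M.gammaStar y (diff y u) x = 0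

variable {M}

theorem isErgodicSol_iff {ϱ : ℝ} {u μ : Fin d → ℝ} :
    M.IsErgodicSol ϱ u μ ↔ M.IsErgodicTriple (fun x => M.F x μ) ϱ u μ :=
  ⟨fun h => ⟨h.1, h.2.1, fun x => by linarith [h.2.2.1 x], h.2.2.2⟩,
    fun h => ⟨h.1, h.2, fun x => by linarith [h.3 x], h.4⟩⟩

namespace Assumptions

variable (hM : M.Assumptions)
include hM

theorem gammaStar_ge (u : Fin d → ℝ) {x y : Fin d} (hxy : x ≠ y) :
    M.al ≤ M.gammaStar x (diff x u) y :=
  ((hM.gammaStar_mem x _).1 y hxy.symm).1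

/-- Bound on the oscillation of solutions of the Hamilton--Jacobi equation. -/
theorem abs_sub_le_of_hamiltonJacobi {u φ : Fin d → ℝ} {ϱ A B : ℝ} (hB : ∀ x, |M.H x 0| ≤ B)
    (hu : ∀ x, M.H x (diff x u) + φ x = ϱ) (hφ : ∀ x y, u y ≤ u x → φ x - φ y ≤ A) (x y : Fin d) :
    |u x - u y| ≤ (2 * B + A) / (2 * M.al) := by
  have hal := hM.al_pos
  have : Nonempty (Fin d) := ⟨x⟩
  obtain ⟨a, ha⟩ := Finite.exists_max u
  obtain ⟨b, hb⟩ := Finite.exists_min u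
  -- Comparing the equations at the maximum `a` and the minimum `b` gives `2 * al * (u a - u b) ≤ 2
  -- * B + A`. Only `φ a - φ b` enters, so the term `-r • u` of the discounted problem has a
  -- favourable sign and costs nothing.
  have h1 := hM.H_le_of_nonpos (x := a) (p := diff a u) (fun y => sub_nonpos.2 (ha y))
    (diff_self a u) b
  have h2 := hM.H_ge_of_nonneg (x := b) (p := diff b u) (fun y => sub_nonneg.2 (hb y))
    (diff_self b u) a
  have h3 := hφ a b (ha b)
  have h4 := abs_le.1 (hB a)
  have h5 := abs_le.1 (hB b)
  have h6 := hu a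
  have h7 := hu b
  simp only [diff] at h1 h2
  have h8 : u a - u b ≤ (2 * B + A) / (2 * M.al) := by
    rw [le_div_iff₀ (by positivity)]
    linarith
  rw [abs_le]
  constructor <;> linarith [ha x, ha y, hb x, hb y]

theorem stationary_lower_bound {u μ : Fin d → ℝ} (hμ : μ ∈ stdSimplex ℝ (Fin d))
    (hs : ∀ x, ∑ y, μ y * M.gammaStar y (diff y u) x = 0) (x : Fin d) :
    M.al / (M.al + d * M.au) ≤ μ x :=
  le_of_stationary (α := fun x y => M.gammaStar x (diff x u) y) hM.al_pos
    (fun _ _ hxy => hM.gammaStar_ge u hxy) (fun x => hM.diag_ge (hM.gammaStar_mem x _))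
    (mul_nonneg (Nat.cast_nonneg d) hM.au_pos.le) hμ hs x

theorem lower_bound_pos : 0 < M.al / (M.al + d * M.au) := by
  have h1 := hM.al_pos
  have h2 := hM.au_pos
  positivity

/-- Adjointness of the forward operator and the generator; since rates sum to zero, `v` may be
replaced by its differences. -/
theorem sum_mul_gammaStar_comm (μ u v : Fin d → ℝ) :
    ∑ x, (∑ y, μ y * M.gammaStar y (diff y u) x) * v x =
      ∑ y, μ y * ∑ x, M.gammaStar y (diff y u) x * diff y v x := by
  simp_rw [sum_mul_diff (hM.sum_gammaStar _ _), Finset.sum_mul, Finset.mul_sum]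
  rw [Finset.sum_comm]
  exact Finset.sum_congr rfl fun y _ => Finset.sum_congr rfl fun x _ => by ring

/-- The Lasry--Lions duality identity. -/
theorem duality (u u' μ μ' : Fin d → ℝ) :
    ∑ x, (M.H x (diff x u) - M.H x (diff x u')) * (μ x - μ' x) =
      ∑ y, μ y * (M.H y (diff y u) +
          ∑ x, M.gammaStar y (diff y u) x * (diff y u' x - diff y u x) - M.H y (diff y u')) +
        ∑ y, μ' y * (M.H y (diff y u') +
          ∑ x, M.gammaStar y (diff y u') x * (diff y u x - diff y u' x) - M.H y (diff y u)) +
        ∑ x, (∑ y, μ y * M.gammaStar y (diff y u) x) * (u x - u' x) -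
        ∑ x, (∑ y, μ' y * M.gammaStar y (diff y u') x) * (u x - u' x) := by
  have h1 := hM.sum_mul_gammaStar_comm μ u (u - u')
  have h2 := hM.sum_mul_gammaStar_comm μ' u' (u - u')
  simp only [Pi.sub_apply, diff_sub] at h1 h2
  rw [h1, h2, ← Finset.sum_add_distrib, ← Finset.sum_add_distrib, ← Finset.sum_sub_distrib]
  refine Finset.sum_congr rfl fun y _ => ?_
  have h3 : ∑ x, M.gammaStar y (diff y u) x * (diff y u' x - diff y u x) =
      -∑ x, M.gammaStar y (diff y u) x * (diff y u x - diff y u' x) := by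
    rw [← Finset.sum_neg_distrib]
    exact Finset.sum_congr rfl fun x _ => by ring
  rw [h3]
  ring

/-- Stability of the ergodic system: constants are uniform for potentials `u` in a box. -/
theorem exists_stability {K : ℝ} (hK : 0 < K) : ∃ C : ℝ, 0 < C ∧ ∀ φ φ' ϱ ϱ' u u' μ μ',
    M.IsErgodicTriple φ ϱ u μ → M.IsErgodicTriple φ' ϱ' u' μ' →
    (∀ x y, |u x - u y| ≤ K) → (∀ x y, |u' x - u' y| ≤ K) →
      diffNorm (u - u') ^ 2 ≤ C * -∑ x, (φ x - φ' x) * (μ x - μ' x) ∧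
      ∑ x, |μ x - μ' x| ≤ C * diffNorm (u - u') := by
  obtain ⟨c, hc, hconc⟩ := hM.exists_strongly_concave hK
  obtain ⟨L, hL0, hL⟩ := hM.exists_gammaStar_lipschitz hK
  set κ := M.al / (M.al + d * M.au)
  have hκ : 0 < κ := hM.lower_bound_pos
  have hal := hM.al_pos
  refine ⟨1 / (c * κ) + L / M.al, by positivity, ?_⟩
  intro φ φ' ϱ ϱ' u u' μ μ' h h' hu hu'
  have hbox : ∀ x y, |diff x u y| ≤ K := fun x y => hu y x
  have hbox' : ∀ x y, |diff x u' y| ≤ K := fun x y => hu' y x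
  have hmass : ∑ x, (μ x - μ' x) = 0 := by
    rw [Finset.sum_sub_distrib, h.mem.2, h'.mem.2, sub_self]
  have hdual := hM.duality u u' μ μ'
  simp only [h.stationary, h'.stationary, zero_mul, Finset.sum_const_zero, add_zero,
    sub_zero] at hdual
  -- The ergodic constants drop out because `μ - μ'` has mass zero.
  have hleft : ∑ x, (M.H x (diff x u) - M.H x (diff x u')) * (μ x - μ' x) =
      -∑ x, (φ x - φ' x) * (μ x - μ' x) := by
    have : ∀ x, (M.H x (diff x u) - M.H x (diff x u')) * (μ x - μ' x) =
        (ϱ - ϱ') * (μ x - μ' x) - (φ x - φ' x) * (μ x - μ' x) := fun x => by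
      rw [← h.hamiltonJacobi x, ← h'.hamiltonJacobi x]; ring
    simp_rw [this, Finset.sum_sub_distrib, ← Finset.mul_sum]
    rw [hmass]; ring
  -- Of the two concavity gaps in the duality identity, the one weighted by `μ ≥ κ` gives the
  -- coercive term; for the other one its sign is enough.
  have hE : c * κ * diffNorm (u - u') ^ 2 ≤ -∑ x, (φ x - φ' x) * (μ x - μ' x) := by
    rw [← hleft, hdual]
    have h1 : c * κ * diffNorm (u - u') ^ 2 ≤ ∑ y, μ y * (M.H y (diff y u) +
          ∑ x, M.gammaStar y (diff y u) x * (diff y u' x - diff y u x) - M.H y (diff y u')) := by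
      rw [diffNorm_sq, Finset.mul_sum]
      refine Finset.sum_le_sum fun y _ => ?_
      have h2 := hconc y _ _ (hbox y) (hbox' y) (by rw [diff_self, diff_self])
      have h3 : eucl (diff y (u - u')) ^ 2 = eucl (diff y u' - diff y u) ^ 2 := by
        rw [diff_sub, eucl_sq, eucl_sq]
        exact Finset.sum_congr rfl fun x _ => by simp only [Pi.sub_apply]; ring
      have h4 := hM.stationary_lower_bound h.mem h.stationary y
      rw [h3]
      calc c * κ * eucl (diff y u' - diff y u) ^ 2
          = κ * (c * eucl (diff y u' - diff y u) ^ 2) := by ring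
        _ ≤ μ y * (c * eucl (diff y u' - diff y u) ^ 2) :=
            mul_le_mul_of_nonneg_right h4 (by positivity)
        _ ≤ _ := mul_le_mul_of_nonneg_left (by linarith) (h.mem.1 y)
    have h2 : 0 ≤ ∑ y, μ' y * (M.H y (diff y u') +
          ∑ x, M.gammaStar y (diff y u') x * (diff y u x - diff y u' x) - M.H y (diff y u)) :=
      Finset.sum_nonneg fun y _ => mul_nonneg (h'.mem.1 y)
        (sub_nonneg.2 (hM.H_le_add y (diff y u') (diff y u)))
    linarith
  have hE' : diffNorm (u - u') ^ 2 ≤ 1 / (c * κ) * -∑ x, (φ x - φ' x) * (μ x - μ' x) := by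
    rw [one_div, ← div_eq_inv_mul, le_div_iff₀ (by positivity)]
    linarith
  have hnn : 0 ≤ -∑ x, (φ x - φ' x) * (μ x - μ' x) :=
    le_trans (by positivity) hE
  refine ⟨hE'.trans ?_, ?_⟩
  · refine mul_le_mul_of_nonneg_right ?_ hnn
    have : 0 ≤ L / M.al := by positivity
    linarith
  -- By both stationarity equations, applying the rates of `u` to `μ - μ'` equals applying a
  -- difference of rates to `μ'`. The rate matrix is bounded below on vectors of mass zero.
  · have h1 := card_mul_sum_abs_le (α := fun x y => M.gammaStar x (diff x u) y)
      (fun _ _ hxy => hM.gammaStar_ge u hxy) (fun x => hM.sum_gammaStar x _) hmass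
    have h2 : ∀ x, |∑ y, (μ y - μ' y) * M.gammaStar y (diff y u) x| ≤ L * diffNorm (u - u') := by
      intro x
      have h3 : ∑ y, (μ y - μ' y) * M.gammaStar y (diff y u) x =
          ∑ y, μ' y * (M.gammaStar y (diff y u') x - M.gammaStar y (diff y u) x) := by
        simp only [sub_mul, mul_sub, Finset.sum_sub_distrib, h.stationary, h'.stationary]
      rw [h3]
      calc _ ≤ ∑ y, |μ' y * (M.gammaStar y (diff y u') x - M.gammaStar y (diff y u) x)| :=
            Finset.abs_sum_le_sum_abs _ _
        _ ≤ ∑ y, μ' y * (L * diffNorm (u - u')) := by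
            refine Finset.sum_le_sum fun y _ => ?_
            rw [abs_mul, abs_of_nonneg (h'.mem.1 y), abs_sub_comm]
            refine mul_le_mul_of_nonneg_left ?_ (h'.mem.1 y)
            refine (hL y _ _ (hbox y) (hbox' y) x).trans ?_
            rw [← diff_sub]
            exact mul_le_mul_of_nonneg_left (norm_diff_le_diffNorm y _) hL0
        _ = _ := by rw [← Finset.sum_mul, h'.mem.2, one_mul]
    have h4 : d * M.al * ∑ x, |μ x - μ' x| ≤ d * (L * diffNorm (u - u')) := by
      refine h1.trans ((Finset.sum_le_sum fun x _ => h2 x).trans_eq ?_)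
      simp
    have hDn := diffNorm_nonneg (u - u')
    rcases Nat.eq_zero_or_pos d with rfl | hd
    · simp only [Finset.univ_eq_empty, Finset.sum_empty]; positivity
    have hd' : (0 : ℝ) < d := by exact_mod_cast hd
    have h5 : M.al * ∑ x, |μ x - μ' x| ≤ L * diffNorm (u - u') := by
      rw [mul_assoc] at h4
      exact le_of_mul_le_mul_left h4 hd'
    have h6 : ∑ x, |μ x - μ' x| ≤ L / M.al * diffNorm (u - u') := by
      rw [div_mul_eq_mul_div, le_div_iff₀ hal]; linarith
    have h7 : 0 ≤ 1 / (c * κ) * diffNorm (u - u') := by positivity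
    linarith

/-- Existence for the ergodic system with a continuous monotone coupling `G`. -/
theorem exists_isErgodicTriple (hd : 0 < d) (G : (Fin d → ℝ) → Fin d → ℝ)
    (hG : ∀ x, ContinuousOn (fun η => G η x) (stdSimplex ℝ (Fin d)))
    (hmono : ∀ η ∈ stdSimplex ℝ (Fin d), ∀ η' ∈ stdSimplex ℝ (Fin d),
      0 ≤ ∑ x, (G η x - G η' x) * (η x - η' x)) :
    ∃ ϱ u μ, M.IsErgodicTriple (G μ) ϱ u μ := by
  have hne : Nonempty (Fin d) := ⟨⟨0, hd⟩⟩
  have hal := hM.al_pos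
  obtain ⟨A, hA⟩ : ∃ A : ℝ, ∀ η ∈ stdSimplex ℝ (Fin d), ∀ x, |G η x| + |M.H x 0| ≤ A := by
    choose A hA using fun x =>
      (isCompact_stdSimplex ℝ (Fin d)).exists_bound_of_continuousOn (hG x)
    refine ⟨∑ x, (|A x| + |M.H x 0|), fun η hη x => ?_⟩
    refine le_trans ?_ (Finset.single_le_sum (f := fun x => |A x| + |M.H x 0|)
      (fun _ _ => by positivity) (Finset.mem_univ x))
    exact add_le_add ((hA x η hη).trans (le_abs_self _)) le_rfl
  -- The a priori oscillation bound plus a margin of one, so that the potential found below can be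
  -- perturbed within the box.
  set R := 2 * A / M.al + 1 with hR
  set U : Set (Fin d → ℝ) := {u | ∑ x, u x = 0} ∩ Set.Icc (fun _ => -R) (fun _ => R) with hU
  have hUc : IsCompact U := isCompact_Icc.inter_left
    (isClosed_eq (by fun_prop) continuous_const)
  have hUconv : Convex ℝ U := by
    refine Convex.inter ?_ (convex_Icc _ _)
    intro u hu v hv a b _ _ _
    simp only [Set.mem_ofPred_eq] at hu hv ⊢
    simp [Finset.sum_add_distrib, ← Finset.mul_sum, hu, hv]
  have hA0 : 0 ≤ A := by
    obtain ⟨x⟩ := hne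
    exact le_trans (by positivity) (hA _ (single_mem_stdSimplex ℝ x) x)
  have hR0 : 0 ≤ R := by positivity
  have h0U : (0 : Fin d → ℝ) ∈ U := ⟨by simp, mem_box_iff.2 fun y => by simpa using hR0⟩
  let B : (Fin d → ℝ) × (Fin d → ℝ) → ((Fin d → ℝ) × (Fin d → ℝ)) →L[ℝ] ℝ := fun z =>
    LinearMap.toContinuousLinearMap
      { toFun := fun v => ∑ x, (G z.1 x + M.H x (diff x z.2)) * v.1 x -
          ∑ x, (∑ y, z.1 y * M.gammaStar y (diff y z.2) x) * v.2 x
        map_add' := fun v w => by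
          simp only [Prod.fst_add, Prod.snd_add, Pi.add_apply, mul_add, Finset.sum_add_distrib]
          ring
        map_smul' := fun t v => by
          simp only [Prod.smul_fst, Prod.smul_snd, Pi.smul_apply, smul_eq_mul, mul_left_comm _ t,
            ← Finset.mul_sum, RingHom.id_apply]
          ring }
  have hBapp : ∀ z v, B z v = ∑ x, (G z.1 x + M.H x (diff x z.2)) * v.1 x -
      ∑ x, (∑ y, z.1 y * M.gammaStar y (diff y z.2) x) * v.2 x := fun _ _ => rfl
  have hdiffc : ∀ x, Continuous fun z : (Fin d → ℝ) × (Fin d → ℝ) => diff x z.2 := fun x => by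
    unfold diff; fun_prop
  obtain ⟨⟨μ, u⟩, ⟨hμ, hu⟩, hVI⟩ := exists_variational_inequality
    ((isCompact_stdSimplex ℝ (Fin d)).prod hUc) ((convex_stdSimplex ℝ (Fin d)).prod hUconv)
    ⟨(_, _), single_mem_stdSimplex ℝ hne.some, h0U⟩ B
    (fun v => by
      simp only [hBapp]
      refine ContinuousOn.sub ?_ ?_
      · refine continuousOn_finsetSum _ fun x _ => ContinuousOn.mul (ContinuousOn.add ?_ ?_)
          continuousOn_const
        · exact (hG x).comp continuous_fst.continuousOn fun z hz => hz.1
        · exact ((hM.continuous_H x).comp (hdiffc x)).continuousOn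
      · refine Continuous.continuousOn ?_
        refine continuous_finsetSum _ fun x _ => Continuous.mul ?_ continuous_const
        refine continuous_finsetSum _ fun y _ => Continuous.mul (by fun_prop) ?_
        exact (hM.continuous_gammaStar y x).comp (hdiffc y))
    (by
      rintro ⟨μ, u⟩ ⟨hμ, hu⟩ ⟨μ', u'⟩ ⟨hμ', hu'⟩
      have h1 := hmono μ hμ μ' hμ'
      have h2 := hM.duality u u' μ μ'
      have h3 : ∀ (a b μ μ' : Fin d → ℝ), (∀ x, 0 ≤ μ x) → (∀ x, b x ≤ a x) →
          0 ≤ ∑ x, μ x * (a x - b x) := fun a b μ μ' h h' =>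
        Finset.sum_nonneg fun x _ => mul_nonneg (h x) (sub_nonneg.2 (h' x))
      have h4 := h3 _ _ μ μ hμ.1 (fun y => hM.H_le_add y (diff y u) (diff y u'))
      have h5 := h3 _ _ μ' μ hμ'.1 (fun y => hM.H_le_add y (diff y u') (diff y u))
      have h6 : ∑ x, (G μ x + M.H x (diff x u)) * (μ x - μ' x) -
          ∑ x, (G μ' x + M.H x (diff x u')) * (μ x - μ' x) =
          ∑ x, (G μ x - G μ' x) * (μ x - μ' x) +
            ∑ x, (M.H x (diff x u) - M.H x (diff x u')) * (μ x - μ' x) := by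
        rw [← Finset.sum_sub_distrib, ← Finset.sum_add_distrib]
        exact Finset.sum_congr rfl fun x _ => by ring
      simp only [hBapp, Prod.fst_sub, Prod.snd_sub, Pi.sub_apply]
      linarith)
  simp only [hBapp, Prod.fst_sub, Prod.snd_sub] at hVI hμ hu
  set Ψ : Fin d → ℝ := fun x => G μ x + M.H x (diff x u) with hΨ
  set b : Fin d → ℝ := fun x => ∑ y, μ y * M.gammaStar y (diff y u) x with hb
  -- testing with Dirac masses
  have hmin : ∀ x, ∑ y, μ y * Ψ y ≤ Ψ x := by
    intro x
    have h := hVI (Pi.single x 1, u) ⟨single_mem_stdSimplex ℝ x, hu⟩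
    simp only [sub_self, mul_zero, Finset.sum_const_zero, sub_zero, Pi.sub_apply,
      mul_sub, Finset.sum_sub_distrib] at h
    rw [Finset.sum_eq_single x (fun y _ hy => by simp [hy]) (by simp)] at h
    simp only [Pi.single_eq_same, mul_one] at h
    have h2 : ∑ y, μ y * Ψ y = ∑ y, (G μ y + M.H y (diff y u)) * μ y :=
      Finset.sum_congr rfl fun y _ => mul_comm _ _
    rw [h2]
    linarith
  -- testing with the zero potential
  have hzero : 0 ≤ ∑ y, μ y * ∑ x, M.gammaStar y (diff y u) x * diff y u x := by
    have h := hVI (μ, 0) ⟨hμ, h0U⟩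
    simp only [sub_self, Pi.zero_apply, mul_zero, Finset.sum_const_zero, zero_sub, Pi.neg_apply,
      mul_neg, Finset.sum_neg_distrib, neg_neg] at h
    rwa [← hM.sum_mul_gammaStar_comm]
  -- At the maximum `a`, `Ψ a` is at most `A` minus `al` times the oscillation, and at least the
  -- `μ`-average of `Ψ`. By `hzero` that average is at least `-A`.
  have hosc : ∀ x y, |u x - u y| ≤ 2 * A / M.al := by
    obtain ⟨a, ha⟩ := Finite.exists_max u
    obtain ⟨c, hc⟩ := Finite.exists_min u
    have h1 := hM.H_le_of_nonpos (x := a) (p := diff a u) (fun y => sub_nonpos.2 (ha y))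
      (diff_self a u) c
    have h2 := hmin a
    have h3 : ∑ y, μ y * -A ≤ ∑ y, μ y * (Ψ y - ∑ x, M.gammaStar y (diff y u) x * diff y u x) := by
      refine Finset.sum_le_sum fun y _ => mul_le_mul_of_nonneg_left ?_ (hμ.1 y)
      have h4 := hM.sum_gammaStar_mul_le y (diff y u)
      have h5 := hA μ hμ y
      have h6 := neg_abs_le (G μ y)
      have h7 := neg_abs_le (M.H y 0)
      simp only [hΨ]
      linarith
    rw [← Finset.sum_mul, hμ.2] at h3
    simp only [mul_sub, Finset.sum_sub_distrib] at h3 hzero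
    have h5 := hA μ hμ a
    have h6 := le_abs_self (G μ a)
    have h7 := le_abs_self (M.H a 0)
    have h8 : u a - u c ≤ 2 * A / M.al := by
      rw [le_div_iff₀ hal]
      simp only [hΨ] at h2
      simp only [show diff a u c = u c - u a from rfl] at h1
      linarith
    intro x y
    rw [abs_le]
    constructor <;> linarith [ha x, ha y, hc x, hc y]
  have hst : ∀ x, b x = 0 := by
    have hbsum : ∑ x, b x = 0 := by
      simp only [hb]
      rw [Finset.sum_comm]
      simp [← Finset.mul_sum, hM.sum_gammaStar]
    -- The perturbation `ε • b` has size at most one and mass zero, so it is admissible; testing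
    -- with it forces `∑ x, b x ^ 2 ≤ 0`.
    set ε := 1 / (1 + ‖b‖) with hε
    have hε0 : 0 < ε := by positivity
    have hmem : u + ε • b ∈ U := by
      refine ⟨?_, mem_box_iff.2 fun x => ?_⟩
      · simp [Finset.sum_add_distrib, ← Finset.mul_sum, hbsum, hu.1.out]
      · have h1 := abs_le_of_sum_eq_zero hu.1.out hosc x
        have h2 : |ε * b x| ≤ 1 := by
          rw [abs_mul, abs_of_pos hε0, hε, one_div, ← div_eq_inv_mul, div_le_one (by positivity)]
          have := norm_le_pi_norm b x
          rw [Real.norm_eq_abs] at this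
          linarith
        calc |u x + ε * b x| ≤ |u x| + |ε * b x| := abs_add_le _ _
          _ ≤ R := by rw [hR]; linarith
    have h := hVI (μ, u + ε • b) ⟨hμ, hmem⟩
    simp only [sub_self, Pi.zero_apply, mul_zero, Finset.sum_const_zero, zero_sub,
      add_sub_cancel_left, Pi.smul_apply, smul_eq_mul] at h
    have h2 : ∑ x, b x * (ε * b x) = ε * ∑ x, b x ^ 2 := by
      rw [Finset.mul_sum]
      exact Finset.sum_congr rfl fun x _ => by ring
    have h3 : ε * ∑ x, b x ^ 2 ≤ 0 := by
      rw [← h2]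
      linarith
    have h4 : ∑ x, b x ^ 2 ≤ 0 := by
      by_contra! h5
      exact absurd h3 (not_le.2 (mul_pos hε0 h5))
    have h5 := (Finset.sum_eq_zero_iff_of_nonneg fun x _ => sq_nonneg (b x)).1
      (le_antisymm h4 (Finset.sum_nonneg fun x _ => sq_nonneg (b x)))
    exact fun x => pow_eq_zero_iff two_ne_zero |>.1 (h5 x (Finset.mem_univ x))
  refine ⟨∑ y, μ y * Ψ y, u, μ, hu.1, hμ, fun x => ?_, hst⟩
  -- Complementary slackness: `Ψ` equals its minimum wherever `μ` is positive, which is everywhere.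
  have h1 : ∑ x, μ x * (Ψ x - ∑ y, μ y * Ψ y) = 0 := by
    simp only [mul_sub, Finset.sum_sub_distrib, ← Finset.sum_mul, hμ.2]
    ring
  have h2 := (Finset.sum_eq_zero_iff_of_nonneg fun x _ =>
    mul_nonneg (hμ.1 x) (sub_nonneg.2 (hmin x))).1 h1 x (Finset.mem_univ x)
  have h3 : 0 < μ x := hM.lower_bound_pos.trans_le (hM.stationary_lower_bound hμ hst x)
  have h4 := (mul_eq_zero.1 h2).resolve_left h3.ne'
  simp only [hΨ] at h4 ⊢
  linarith

end Assumptions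

end Data

/-! ### The discounted system as a perturbation of the ergodic one. -/

namespace Data

variable {M : Data d}

/-- The centered potential of a discounted solution solves an ergodic system. -/
theorem IsStatDiscountedSol.isErgodicTriple (hd : 0 < d) {r : ℝ} {u μ : Fin d → ℝ}
    (h : M.IsStatDiscountedSol r u μ) :
    ∃ v m, u = (fun x => v x + m) ∧
      M.IsErgodicTriple (fun x => M.F x μ - (r • v) x) (r * m) v μ := by
  have hd' : (d : ℝ) ≠ 0 := by exact_mod_cast hd.ne'
  set m := (∑ x, u x) / d with hm
  have hdiff : ∀ x, diff x (fun x => u x - m) = diff x u := fun x => by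
    simpa [sub_eq_add_neg] using diff_add_const x u (-m)
  refine ⟨fun x => u x - m, m, by simp, ?_, h.1, fun x => ?_, fun x => ?_⟩
  · rw [Finset.sum_sub_distrib]
    simp [hm]; field_simp; simp
  · rw [hdiff]
    have := h.2.1 x
    simp only [Pi.smul_apply, smul_eq_mul]
    linarith
  · simp_rw [hdiff]
    exact h.2.2 x

theorem IsErgodicTriple.isStatDiscountedSol {r ϱ : ℝ} (hr : r ≠ 0) {v μ : Fin d → ℝ}
    (h : M.IsErgodicTriple (fun x => M.F x μ - (r • v) x) ϱ v μ) :
    M.IsStatDiscountedSol r (fun x => v x + ϱ / r) μ := by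
  refine ⟨h.mem, fun x => ?_, fun x => ?_⟩
  · rw [diff_add_const]
    have := h.hamiltonJacobi x
    simp only [Pi.smul_apply, smul_eq_mul] at this
    rw [mul_add, mul_div_cancel₀ _ hr]
    linarith
  · simp_rw [diff_add_const]
    exact h.stationary x

/-- `K` bounds the potentials of the ergodic systems perturbed by `w` with `‖w‖ ≤ 1`, and of the
centered discounted systems. -/
structure IsPotentialBound (M : Data d) (K : ℝ) : Prop where
  perturbed : ∀ (w : Fin d → ℝ) (ϱ : ℝ) (u μ : Fin d → ℝ), ‖w‖ ≤ 1 →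
    M.IsErgodicTriple (fun x => M.F x μ - w x) ϱ u μ → ‖u‖ ≤ K
  discounted : ∀ (r ϱ : ℝ) (u μ : Fin d → ℝ), 0 ≤ r →
    M.IsErgodicTriple (fun x => M.F x μ - (r • u) x) ϱ u μ → ‖u‖ ≤ K

/-- Solutions of the perturbed ergodic system are `C`-Lipschitz in the perturbation. -/
def IsStabilityConstant (M : Data d) (C : ℝ) : Prop :=
  ∀ (w w' : Fin d → ℝ) (ϱ ϱ' : ℝ) (u u' μ μ' : Fin d → ℝ), ‖w‖ ≤ 1 → ‖w'‖ ≤ 1 →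
    M.IsErgodicTriple (fun x => M.F x μ - w x) ϱ u μ →
    M.IsErgodicTriple (fun x => M.F x μ' - w' x) ϱ' u' μ' →
    diffNorm (u - u') ≤ C * ‖w - w'‖ ∧ ‖μ - μ'‖ ≤ C * ‖w - w'‖ ∧ |ϱ - ϱ'| ≤ C * ‖w - w'‖

namespace Assumptions

variable (hM : M.Assumptions)
include hM

/-- A priori bounds and stability, uniform over perturbations `w` of size at most one. -/
theorem exists_uniform_constants (hd : 0 < d) : ∃ K C : ℝ, 0 < K ∧ 0 < C ∧
    M.IsPotentialBound K ∧ M.IsStabilityConstant C := by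
  have hal := hM.al_pos
  have hau := hM.au_pos
  obtain ⟨BF, hBF0, hBF⟩ := hM.exists_F_bound
  obtain ⟨LF, hLF0, hLF⟩ := hM.exists_F_lipschitz
  set BH := ∑ x, |M.H x 0| with hBH
  have hBH' : ∀ x, |M.H x 0| ≤ BH := fun x =>
    Finset.single_le_sum (f := fun x => |M.H x 0|) (fun _ _ => abs_nonneg _) (Finset.mem_univ x)
  have hBH0 : 0 ≤ BH := Finset.sum_nonneg fun _ _ => abs_nonneg _
  set K := (2 * BH + (2 * BF + 2)) / (2 * M.al) with hK
  have hK0 : 0 < K := by positivity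
  have hF : ∀ μ ∈ stdSimplex ℝ (Fin d), ∀ x y, M.F x μ - M.F y μ ≤ 2 * BF := fun μ hμ x y => by
    have h1 := (abs_le.1 (hBF x μ hμ)).2
    have h2 := (abs_le.1 (hBF y μ hμ)).1
    linarith
  have hosc : ∀ (w : Fin d → ℝ) (ϱ : ℝ) (u μ : Fin d → ℝ), ‖w‖ ≤ 1 → M.IsErgodicTriple (fun x => M.F x μ - w x) ϱ u μ →
      ∀ x y, |u x - u y| ≤ K := by
    intro w ϱ u μ hw h
    refine hM.abs_sub_le_of_hamiltonJacobi hBH' h.hamiltonJacobi fun x y _ => ?_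
    have h1 := hF μ h.mem x y
    have h2 := (abs_le.1 ((norm_le_pi_norm w x).trans hw)).1
    have h3 := (abs_le.1 ((norm_le_pi_norm w y).trans hw)).2
    linarith
  obtain ⟨C, hC0, hC⟩ := hM.exists_stability hK0
  -- The three groups are the constants for `u`, for `μ`, and for `ϱ`, which is read off from the
  -- equation at a single state.
  refine ⟨K, C ^ 2 + C ^ 3 + (d * (d * M.au) * C ^ 2 + LF * C ^ 3 + 1), hK0, by positivity,
    ⟨?_, ?_⟩, ?_⟩
  · intro w ϱ u μ hw h
    exact (pi_norm_le_iff_of_nonneg hK0.le).2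
      (abs_le_of_sum_eq_zero h.sum_eq_zero (hosc w ϱ u μ hw h))
  · intro r ϱ u μ hr h
    refine (pi_norm_le_iff_of_nonneg hK0.le).2 (abs_le_of_sum_eq_zero h.sum_eq_zero ?_)
    refine hM.abs_sub_le_of_hamiltonJacobi hBH' h.hamiltonJacobi fun x y hxy => ?_
    have h1 := hF μ h.mem x y
    have h2 := mul_le_mul_of_nonneg_left hxy hr
    simp only [Pi.smul_apply, smul_eq_mul]
    linarith
  · intro w w' ϱ ϱ' u u' μ μ' hw hw' h h'
    obtain ⟨h1, h2⟩ := hC _ _ _ _ _ _ _ _ h h' (hosc w ϱ u μ hw h) (hosc w' ϱ' u' μ' hw' h')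
    set δ := ‖w - w'‖ with hδ
    have hδ0 : 0 ≤ δ := norm_nonneg _
    set D := diffNorm (u - u') with hD
    have hD0 : 0 ≤ D := diffNorm_nonneg _
    -- Monotonicity of `F` discards the coupling. What remains is linear in `D`, so that one factor
    -- `D` of `D ^ 2` cancels below.
    have h3 : -∑ x, ((M.F x μ - w x) - (M.F x μ' - w' x)) * (μ x - μ' x) ≤ δ * (C * D) := by
      have h4 := hM.F_monotone μ h.mem μ' h'.mem
      have h5 : ∑ x, (w x - w' x) * (μ x - μ' x) ≤ δ * ∑ x, |μ x - μ' x| := by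
        rw [Finset.mul_sum]
        refine Finset.sum_le_sum fun x _ => (le_abs_self _).trans ?_
        rw [abs_mul]
        exact mul_le_mul_of_nonneg_right (norm_le_pi_norm (w - w') x) (abs_nonneg _)
      have h6 : ∑ x, ((M.F x μ - w x) - (M.F x μ' - w' x)) * (μ x - μ' x) =
          ∑ x, (M.F x μ - M.F x μ') * (μ x - μ' x) - ∑ x, (w x - w' x) * (μ x - μ' x) := by
        rw [← Finset.sum_sub_distrib]
        exact Finset.sum_congr rfl fun x _ => by ring
      have h7 := mul_le_mul_of_nonneg_left h2 hδ0
      linarith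
    have h4 : D ≤ C ^ 2 * δ := by
      rcases hD0.eq_or_lt with h0 | h0
      · rw [← h0]; positivity
      · have h5 : D * D ≤ (C ^ 2 * δ) * D := by
          have := mul_le_mul_of_nonneg_left h3 hC0.le
          nlinarith
        exact le_of_mul_le_mul_right h5 h0
    have h5 : ∑ x, |μ x - μ' x| ≤ C ^ 3 * δ := by
      refine h2.trans ((mul_le_mul_of_nonneg_left h4 hC0.le).trans_eq ?_)
      ring
    have h6 : ‖μ - μ'‖ ≤ C ^ 3 * δ := by
      refine le_trans ((pi_norm_le_iff_of_nonneg
        (Finset.sum_nonneg fun _ _ => abs_nonneg _)).2 fun x => ?_) h5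
      exact Finset.single_le_sum (f := fun x => |μ x - μ' x|) (fun _ _ => abs_nonneg _)
        (Finset.mem_univ x)
    have h7 : |ϱ - ϱ'| ≤ (d * (d * M.au) * C ^ 2 + LF * C ^ 3 + 1) * δ := by
      let x : Fin d := ⟨0, hd⟩
      have e : ϱ - ϱ' = (M.H x (diff x u) - M.H x (diff x u')) + (M.F x μ - M.F x μ')
          - (w - w') x := by
        rw [← h.hamiltonJacobi x, ← h'.hamiltonJacobi x, Pi.sub_apply]; ring
      have e1 : |M.H x (diff x u) - M.H x (diff x u')| ≤ d * (d * M.au) * (C ^ 2 * δ) := by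
        refine (hM.abs_H_sub_le x _ _).trans ?_
        rw [← diff_sub]
        exact mul_le_mul_of_nonneg_left ((norm_diff_le_diffNorm x _).trans h4) (by positivity)
      have e2 : |M.F x μ - M.F x μ'| ≤ LF * (C ^ 3 * δ) :=
        (hLF x μ h.mem μ' h'.mem).trans (mul_le_mul_of_nonneg_left h5 hLF0)
      have e3 : |(w - w') x| ≤ δ := norm_le_pi_norm (w - w') x
      rw [e]
      refine ((abs_sub _ _).trans (add_le_add (abs_add_le _ _) le_rfl)).trans ?_
      linarith
    have hp1 : 0 ≤ C ^ 2 * δ := by positivity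
    have hp2 : 0 ≤ C ^ 3 * δ := by positivity
    have hp3 : 0 ≤ (d * (d * M.au) * C ^ 2 + LF * C ^ 3 + 1) * δ := by positivity
    refine ⟨?_, ?_, ?_⟩ <;> rw [add_mul, add_mul] <;> linarith

theorem exists_perturbed_sol (hd : 0 < d) (w : Fin d → ℝ) :
    ∃ ϱ u μ, M.IsErgodicTriple (fun x => M.F x μ - w x) ϱ u μ := by
  refine hM.exists_isErgodicTriple hd (fun η x => M.F x η - w x)
    (fun x => (hM.continuousOn_F x).sub continuousOn_const) fun η hη η' hη' => ?_
  simpa using hM.F_monotone η hη η' hη'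

/-- The ergodic system has a unique solution. -/
theorem existsUnique_isErgodicSol (hd : 0 < d) :
    ∃! s : ℝ × (Fin d → ℝ) × (Fin d → ℝ), M.IsErgodicSol s.1 s.2.1 s.2.2 := by
  obtain ⟨K, C, -, -, -, hC⟩ := hM.exists_uniform_constants hd
  obtain ⟨ϱ, u, μ, h⟩ := hM.exists_perturbed_sol hd 0
  simp only [Pi.zero_apply, sub_zero] at h
  refine ⟨(ϱ, u, μ), isErgodicSol_iff.2 h, ?_⟩
  rintro ⟨ϱ', u', μ'⟩ h'
  have h'' := isErgodicSol_iff.1 h'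
  obtain ⟨h1, h2, h3⟩ := hC 0 0 ϱ' ϱ u' u μ' μ (by simp) (by simp) (by simpa using h'')
    (by simpa using h)
  simp only [sub_self, norm_zero, mul_zero] at h1 h2 h3
  have hu : u' - u = 0 := norm_le_zero_iff.1 ((norm_le_diffNorm (by
    simp [Finset.sum_sub_distrib, h.sum_eq_zero, h''.sum_eq_zero])).trans h1)
  have hμ : μ' - μ = 0 := norm_le_zero_iff.1 h2
  have hϱ : ϱ' - ϱ = 0 := abs_nonpos_iff.1 h3
  rw [sub_eq_zero.1 hu, sub_eq_zero.1 hμ, sub_eq_zero.1 hϱ]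

/-- Banach's fixed point theorem for `w ↦ r • u w` on the unit ball, which is preserved by `hrK` and
contracted by `hrC`. Every centered discounted solution `v` is bounded by `K` beforehand, so `r • v`
lies in that ball and uniqueness holds without restriction. -/
theorem existsUnique_isStatDiscountedSol (hd : 0 < d) {K C : ℝ}
    (hK : M.IsPotentialBound K) (hC : M.IsStabilityConstant C)
    {r : ℝ} (hr : 0 < r) (hrK : r * K ≤ 1) (hrC : r * C ≤ 1 / 2) :
    ∃! s : (Fin d → ℝ) × (Fin d → ℝ), M.IsStatDiscountedSol r s.1 s.2 := by
  have hsmul : ∀ u : Fin d → ℝ, ‖u‖ ≤ K → ‖r • u‖ ≤ 1 := fun u hu => by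
    rw [norm_smul, Real.norm_eq_abs, abs_of_pos hr]
    exact (mul_le_mul_of_nonneg_left hu hr.le).trans hrK
  have hcontr : ∀ (w w' : Fin d → ℝ) (ϱ ϱ' : ℝ) (u u' μ μ' : Fin d → ℝ), ‖w‖ ≤ 1 → ‖w'‖ ≤ 1 →
      M.IsErgodicTriple (fun x => M.F x μ - w x) ϱ u μ →
      M.IsErgodicTriple (fun x => M.F x μ' - w' x) ϱ' u' μ' →
      ‖r • u - r • u'‖ ≤ 1 / 2 * ‖w - w'‖ := by
    intro w w' ϱ ϱ' u u' μ μ' hw hw' h h'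
    have h1 := (hC w w' ϱ ϱ' u u' μ μ' hw hw' h h').1
    have h2 := norm_le_diffNorm (u := u - u')
      (by simp [Finset.sum_sub_distrib, h.sum_eq_zero, h'.sum_eq_zero])
    rw [← smul_sub, norm_smul, Real.norm_eq_abs, abs_of_pos hr]
    calc r * ‖u - u'‖ ≤ r * (C * ‖w - w'‖) := mul_le_mul_of_nonneg_left (h2.trans h1) hr.le
      _ = (r * C) * ‖w - w'‖ := by ring
      _ ≤ _ := mul_le_mul_of_nonneg_right hrC (norm_nonneg _)
  choose ϱ u μ hsol using fun w => hM.exists_perturbed_sol hd w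
  let T : Metric.closedBall (0 : Fin d → ℝ) 1 → Metric.closedBall (0 : Fin d → ℝ) 1 := fun w =>
    ⟨r • u w, mem_closedBall_zero_iff.2
      (hsmul _ (hK.perturbed w _ _ _ (mem_closedBall_zero_iff.1 w.2) (hsol w)))⟩
  have hT : ContractingWith (1 / 2) T := by
    refine ⟨by rw [← NNReal.coe_lt_coe]; norm_num, LipschitzWith.of_dist_le_mul fun w w' => ?_⟩
    rw [Subtype.dist_eq, Subtype.dist_eq, dist_eq_norm, dist_eq_norm]
    simpa using hcontr w w' _ _ _ _ _ _ (mem_closedBall_zero_iff.1 w.2)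
      (mem_closedBall_zero_iff.1 w'.2) (hsol w) (hsol w')
  have : Nonempty (Metric.closedBall (0 : Fin d → ℝ) 1) := ⟨⟨0, by simp⟩⟩
  have : CompleteSpace (Metric.closedBall (0 : Fin d → ℝ) 1) :=
    Metric.isClosed_closedBall.completeSpace_coe
  obtain ⟨p, hp⟩ : ∃ p, T p = p := ⟨_, hT.fixedPoint_isFixedPt⟩
  set w : Fin d → ℝ := p.1
  have hfix : r • u w = w := congrArg Subtype.val hp
  have hw := hsol w
  rw [show (fun x => M.F x (μ w) - w x) = fun x => M.F x (μ w) - (r • u w) x by rw [hfix]] at hw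
  refine ⟨(_, _), hw.isStatDiscountedSol hr.ne', ?_⟩
  rintro ⟨u', μ'⟩ h'
  change M.IsStatDiscountedSol r u' μ' at h'
  obtain ⟨v, m, huv, hv⟩ := IsStatDiscountedSol.isErgodicTriple hd h'
  have hb := hsmul _ (hK.discounted r _ _ _ hr.le hw)
  have hb' := hsmul _ (hK.discounted r _ _ _ hr.le hv)
  have h1 := hcontr _ _ _ _ _ _ _ _ hb' hb hv hw
  have h2 : r • v - r • u w = 0 := by
    have := norm_nonneg (r • v - r • u w)
    exact norm_le_zero_iff.1 (by linarith)
  obtain ⟨-, h3, h4⟩ := hC _ _ _ _ _ _ _ _ hb' hb hv hw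
  rw [h2, norm_zero, mul_zero] at h3 h4
  have h5 := sub_eq_zero.1 (norm_le_zero_iff.1 h3)
  have h6 := sub_eq_zero.1 (abs_nonpos_iff.1 h4)
  have h7 : v = u w := smul_right_injective _ hr.ne' (sub_eq_zero.1 h2)
  have h8 : u' = fun x => u w x + ϱ w / r := by
    rw [huv, h7, ← h6, mul_div_cancel_left₀ _ hr.ne']
  simp only [h8, h5]

/-- Well-posedness of the stationary discounted system for small discount factors, uniform bounds, and
convergence to the ergodic system. -/
theorem stationary_systems (hd : 0 < d) : ∃ r₀ : ℝ, 0 < r₀ ∧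
      (∀ r ∈ Set.Ioo 0 r₀, ∃! s : (Fin d → ℝ) × (Fin d → ℝ), M.IsStatDiscountedSol r s.1 s.2) ∧
      (∃ C : ℝ, 0 < C ∧ ∀ r ∈ Set.Ioo 0 r₀, ∀ u μ, M.IsStatDiscountedSol r u μ →
        eucl (r • u) ≤ C ∧ ∀ x, C⁻¹ ≤ μ x) ∧
      ∀ ϱ u μ, M.IsErgodicSol ϱ u μ →
        ∃ C : ℝ, 0 < C ∧ ∀ r ∈ Set.Ioo 0 r₀, ∀ ur μr, M.IsStatDiscountedSol r ur μr →
          (⨆ x, |r * ur x - ϱ|) + diffNorm (ur - u) + eucl (μr - μ) ≤ C * r ^ (1 / 2 : ℝ) := by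
  obtain ⟨K, C, hK0, hC0, hK, hC⟩ := hM.exists_uniform_constants hd
  have hne : Nonempty (Fin d) := ⟨⟨0, hd⟩⟩
  set r₀ := 1 / (1 + K + 2 * C) with hr₀
  have hr0 : 0 < r₀ := by positivity
  have hsmall : ∀ r ∈ Set.Ioo 0 r₀, r ≤ 1 ∧ r * K ≤ 1 ∧ r * C ≤ 1 / 2 := by
    intro r hr
    have h1 := hr.2
    rw [hr₀, lt_div_iff₀ (by positivity)] at h1
    have h2 := mul_pos hr.1 hK0
    have h3 := mul_pos hr.1 hC0
    have h4 := hr.1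
    refine ⟨?_, ?_, ?_⟩ <;> linarith
  -- A discounted solution is the perturbation `w = r • v` of the ergodic one, and `‖r • v‖ ≤ K *
  -- r`; hence a linear rate.
  have hcomp : ∀ ϱ u μ, M.IsErgodicSol ϱ u μ → ∀ r ∈ Set.Ioo 0 r₀, ∀ ur μr,
      M.IsStatDiscountedSol r ur μr → diffNorm (ur - u) ≤ C * K * r ∧ ‖μr - μ‖ ≤ C * K * r ∧
        ∀ x, |r * ur x - ϱ| ≤ (1 + C) * K * r := by
    intro ϱ u μ h r hr ur μr hsol
    obtain ⟨h1, h2, h3⟩ := hsmall r hr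
    obtain ⟨v, m, rfl, hv⟩ := IsStatDiscountedSol.isErgodicTriple hd hsol
    have hvK := hK.discounted r _ _ _ hr.1.le hv
    have hw : ‖r • v‖ ≤ K * r := by
      rw [norm_smul, Real.norm_eq_abs, abs_of_pos hr.1, mul_comm]
      exact mul_le_mul_of_nonneg_right hvK hr.1.le
    obtain ⟨e1, e2, e3⟩ := hC (r • v) 0 _ ϱ v u _ μ (by linarith) (by simp) hv
      (by simpa using isErgodicSol_iff.1 h)
    rw [sub_zero] at e1 e2 e3
    have hCw : C * ‖r • v‖ ≤ C * K * r := by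
      rw [mul_assoc]; exact mul_le_mul_of_nonneg_left hw hC0.le
    refine ⟨?_, e2.trans hCw, fun x => ?_⟩
    · have : diffNorm ((fun x => v x + m) - u) = diffNorm (v - u) := by
        unfold diffNorm
        simp_rw [diff_sub, diff_add_const]
      rw [this]
      exact e1.trans hCw
    · have e4 : |(r • v) x| ≤ K * r := (norm_le_pi_norm (r • v) x).trans hw
      have e5 : r * (v x + m) - ϱ = (r • v) x + (r * m - ϱ) := by
        simp only [Pi.smul_apply, smul_eq_mul]; ring
      rw [e5]
      refine (abs_add_le _ _).trans ?_
      linarith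
  refine ⟨r₀, hr0, fun r hr => ?_, ?_, ?_⟩
  · obtain ⟨h1, h2, h3⟩ := hsmall r hr
    exact hM.existsUnique_isStatDiscountedSol hd hK hC hr.1 h2 h3
  · obtain ⟨⟨ϱ, u, μ⟩, h, -⟩ := hM.existsUnique_isErgodicSol hd
    set κ := M.al / (M.al + d * M.au)
    have hκ : 0 < κ := hM.lower_bound_pos
    refine ⟨d * (|ϱ| + (1 + C)) + κ⁻¹, by positivity, fun r hr ur μr hsol => ⟨?_, fun x => ?_⟩⟩
    · obtain ⟨h1, h2, h3⟩ := hsmall r hr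
      obtain ⟨-, -, h4⟩ := hcomp ϱ u μ h r hr ur μr hsol
      have h5 : ‖r • ur‖ ≤ |ϱ| + (1 + C) := by
        refine (pi_norm_le_iff_of_nonneg (by positivity)).2 fun x => ?_
        have e : (r • ur) x = ϱ + (r * ur x - ϱ) := by
          simp only [Pi.smul_apply, smul_eq_mul]; ring
        rw [Real.norm_eq_abs, e]
        refine (abs_add_le _ _).trans ?_
        have : (1 + C) * K * r ≤ 1 + C := by
          rw [mul_assoc, mul_comm K]
          exact mul_le_of_le_one_right (by positivity) h2
        linarith [h4 x]
      refine (eucl_le_card_mul_norm _).trans ?_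
      have : 0 < κ⁻¹ := inv_pos.2 hκ
      have := mul_le_mul_of_nonneg_left h5 (Nat.cast_nonneg (α := ℝ) d)
      linarith
    · refine le_trans ?_ (hM.stationary_lower_bound hsol.1 hsol.2.2 x)
      rw [inv_le_comm₀ (by positivity) hκ]
      have : 0 ≤ d * (|ϱ| + (1 + C)) := by positivity
      linarith
  · intro ϱ u μ h
    refine ⟨(1 + C) * K + C * K + d * (C * K), by positivity, fun r hr ur μr hsol => ?_⟩
    obtain ⟨h1, -, -⟩ := hsmall r hr
    obtain ⟨e1, e2, e3⟩ := hcomp ϱ u μ h r hr ur μr hsol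
    have e4 : (⨆ x, |r * ur x - ϱ|) ≤ (1 + C) * K * r := ciSup_le e3
    have e5 : eucl (μr - μ) ≤ d * (C * K * r) :=
      (eucl_le_card_mul_norm _).trans (mul_le_mul_of_nonneg_left e2 (Nat.cast_nonneg d))
    have e6 : r ≤ r ^ (1 / 2 : ℝ) := by
      conv_lhs => rw [← Real.rpow_one r]
      exact Real.rpow_le_rpow_of_exponent_ge hr.1 h1 (by norm_num)
    calc _ ≤ ((1 + C) * K + C * K + d * (C * K)) * r := by linarith
      _ ≤ _ := mul_le_mul_of_nonneg_left e6 (by positivity)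

/-- Positive costs lead to positive discounted potentials. -/
theorem discounted_pos (hpos : ∀ x, ∀ a ∈ M.rateVectors x, ∀ η ∈ stdSimplex ℝ (Fin d),
    0 < M.f x a + M.F x η) {r : ℝ} (hr : 0 < r) {u μ : Fin d → ℝ}
    (h : M.IsStatDiscountedSol r u μ) (x : Fin d) : 0 < u x := by
  have : Nonempty (Fin d) := ⟨x⟩
  -- At a minimum of `u` the jump term is nonnegative, so `r * u b` is at least the positive running
  -- cost.
  obtain ⟨b, hb⟩ := Finite.exists_min u
  refine lt_of_lt_of_le ?_ (hb x)
  have h1 := h.2.1 b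
  have hm := hM.gammaStar_mem b (diff b u)
  have h2 := hpos b _ hm μ h.1
  have h3 : 0 ≤ ∑ y, M.gammaStar b (diff b u) y * diff b u y := by
    refine Finset.sum_nonneg fun y _ => ?_
    by_cases hy : y = b
    · subst hy; rw [diff_self, mul_zero]
    · exact mul_nonneg (hM.al_pos.le.trans (hm.1 y hy).1) (sub_nonneg.2 (hb y))
  rw [hM.H_eq] at h1
  have h4 : 0 < r * u b := by linarith
  exact pos_of_mul_pos_right h4 hr.le

end Assumptions

end Data

/-! ### Time averages and laws of the jump processes. -/

/-- Continuous-time Cesàro means. -/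
theorem tendsto_cesaro_integral {g : ℝ → ℝ} (hg : Continuous g) {L : ℝ}
    (h : Tendsto g atTop (𝓝 L)) :
    Tendsto (fun T : ℝ => (1 / T) * ∫ t in (0 : ℝ)..T, g t) atTop (𝓝 L) := by
  rw [Metric.tendsto_atTop]
  intro ε hε
  obtain ⟨N, hN⟩ := Metric.tendsto_atTop.1 h (ε / 2) (by positivity)
  set T₀ := max N 1
  set A := ∫ t in (0 : ℝ)..T₀, ‖g t - L‖
  have hA0 : 0 ≤ A := intervalIntegral.integral_nonneg
    (le_trans zero_le_one (le_max_right _ _)) fun _ _ => norm_nonneg _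
  refine ⟨max T₀ (2 * A / ε + 1), fun T hT => ?_⟩
  have hT0 : T₀ ≤ T := (le_max_left _ _).trans hT
  have hT1 : 1 ≤ T := (le_max_right _ _).trans hT0
  have hT2 : 2 * A / ε + 1 ≤ T := (le_max_right _ _).trans hT
  have hTpos : 0 < T := by linarith
  have hgi : ∀ a b : ℝ, IntervalIntegrable (fun t => ‖g t - L‖) volume a b := fun a b =>
    (hg.sub continuous_const).norm.intervalIntegrable a b
  have h1 : (1 / T) * (∫ t in (0 : ℝ)..T, g t) - L = (1 / T) * ∫ t in (0 : ℝ)..T, (g t - L) := by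
    rw [intervalIntegral.integral_sub (hg.intervalIntegrable _ _)
      intervalIntegrable_const, intervalIntegral.integral_const]
    simp only [sub_zero, smul_eq_mul]
    field_simp
  have h2 : ‖∫ t in (0 : ℝ)..T, (g t - L)‖ ≤ A + ε / 2 * (T - T₀) := by
    refine (intervalIntegral.norm_integral_le_integral_norm hTpos.le).trans ?_
    rw [← intervalIntegral.integral_add_adjacent_intervals (hgi 0 T₀) (hgi T₀ T)]
    gcongr
    calc ∫ t in T₀..T, ‖g t - L‖ ≤ ∫ _t in T₀..T, ε / 2 := by
          refine intervalIntegral.integral_mono_on hT0 (hgi _ _) intervalIntegrable_const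
            fun t ht => ?_
          have := hN t ((le_max_left _ _).trans ht.1)
          rw [dist_eq_norm] at this
          exact this.le
      _ = _ := by rw [intervalIntegral.integral_const, smul_eq_mul]; ring
  rw [dist_eq_norm, h1, norm_mul, Real.norm_of_nonneg (by positivity), one_div,
    ← div_eq_inv_mul, div_lt_iff₀ hTpos]
  have h3 : 2 * A < ε * T := by
    have : 2 * A / ε < T := by linarith
    rw [div_lt_iff₀ hε] at this
    linarith
  have h4 : 0 ≤ ε / 2 * T₀ := by positivity
  linarith

section Dynamics

variable {Ω : Type*} {mΩ : MeasurableSpace Ω}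

namespace IsJumpProcess

variable {P : Measure Ω} {ℱ : Filtration ℝ≥0 mΩ} {α : Matrix (Fin d) (Fin d) ℝ} {x₀ : Fin d}
  {X : ℝ≥0 → Ω → Fin d}

theorem measurable (h : IsJumpProcess P ℱ α x₀ X) (t : ℝ≥0) : Measurable (X t) :=
  (h.adapted t).mono (ℱ.le t) le_rfl

/-- Right-continuous adapted processes are jointly measurable. -/
theorem measurable_uncurry (h : IsJumpProcess P ℱ α x₀ X) :
    Measurable fun z : ℝ × Ω => X z.1.toNNReal z.2 := by
  -- The times `(⌊(n + 1) t⌋ + 1) / (n + 1)` take countably many values and approach `t` from the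
  -- right.
  obtain ⟨k, hk, hle, hge⟩ : ∃ k : ℕ → ℝ≥0 → ℕ, (∀ n, Measurable (k n)) ∧
      (∀ n t, t ≤ (k n t + 1) / (n + 1 : ℝ≥0)) ∧
      ∀ n t, (k n t + 1) / (n + 1 : ℝ≥0) ≤ t + 1 / (n + 1 : ℝ≥0) := by
    refine ⟨fun n t => ⌊(n + 1 : ℝ≥0) * t⌋₊,
      fun n => Nat.measurable_floor.comp (measurable_id.const_mul _), fun n t => ?_, fun n t => ?_⟩
    · rw [le_div_iff₀ (by positivity), mul_comm]
      exact (Nat.lt_floor_add_one _).le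
    · have hfl : (⌊(n + 1 : ℝ≥0) * t⌋₊ : ℝ≥0) ≤ (n + 1) * t := Nat.floor_le (by positivity)
      rw [div_le_iff₀ (by positivity), add_mul t, div_mul_cancel₀ _ (by positivity), mul_comm t]
      gcongr
  have hlim : ∀ t, Tendsto (fun n => (k n t + 1) / (n + 1 : ℝ≥0)) atTop (𝓝[Set.Ici t] t) := by
    intro t
    refine tendsto_nhdsWithin_iff.2 ⟨?_, Eventually.of_forall fun n => hle n t⟩
    refine tendsto_of_tendsto_of_tendsto_of_le_of_le tendsto_const_nhds ?_
      (fun n => hle n t) (fun n => hge n t)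
    have := (tendsto_one_div_add_atTop_nhds_zero_nat (𝕜 := ℝ≥0)).const_add t
    simpa using this
  have hcomp : ∀ (s : ℕ → ℝ≥0) (κ : ℝ≥0 → ℕ), Measurable κ →
      Measurable fun z : ℝ × Ω => X (s (κ z.1.toNNReal)) z.2 := by
    intro s κ hκ
    have h1 : Measurable fun z : ℕ × Ω => X (s z.1) z.2 :=
      measurable_from_prod_countable_right fun m => h.measurable (s m)
    have h2 : Measurable fun z : ℝ × Ω => (κ z.1.toNNReal, z.2) :=
      (hκ.comp (measurable_real_toNNReal.comp measurable_fst)).prodMk measurable_snd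
    exact h1.comp h2
  have hmeas : ∀ n : ℕ,
      Measurable fun z : ℝ × Ω => X ((k n z.1.toNNReal + 1) / (n + 1 : ℝ≥0)) z.2 := fun n =>
    hcomp (fun m => (m + 1) / (n + 1 : ℝ≥0)) (k n) (hk n)
  refine measurable_of_tendsto_metrizable hmeas (tendsto_pi_nhds.2 fun z => ?_)
  exact (h.right_cont z.2 z.1.toNNReal).tendsto.comp (hlim _)

/-- Conditioning at time `0`, where the state is almost surely `x₀`, leaves a constant; its
expectation is the law. -/
theorem lawFlow_eq [IsProbabilityMeasure P] (h : IsJumpProcess P ℱ α x₀ X) {t : ℝ} (ht : 0 ≤ t) :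
    lawFlow P X t = NormedSpace.exp (t • α) x₀ := by
  funext y
  have hset : MeasurableSet {ω | X t.toNNReal ω = y} :=
    h.measurable t.toNNReal (measurableSet_singleton y)
  have h1 := h.markov 0 t.toNNReal zero_le y
  have h2 : P[{ω | X t.toNNReal ω = y}.indicator (fun _ => (1 : ℝ)) | ℱ 0] =ᵐ[P]
      fun _ => NormedSpace.exp (t • α) x₀ y := by
    filter_upwards [h1, h.start] with ω h1 h2
    rw [h1, h2]
    simp [Real.coe_toNNReal t ht]
  have h3 := integral_condExp (μ := P) (ℱ.le 0)
    (f := {ω | X t.toNNReal ω = y}.indicator (fun _ => (1 : ℝ)))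
  rw [integral_congr_ae h2, integral_indicator hset] at h3
  simp at h3
  rw [h3]
  rfl

/-- Fubini for running costs along the process. -/
theorem integral_cost [IsProbabilityMeasure P] (h : IsJumpProcess P ℱ α x₀ X)
    {c : Fin d → ℝ → ℝ} (hc : ∀ x, Continuous (c x)) {T : ℝ} (hT : 0 ≤ T) :
    ∫ ω, (∫ t in (0 : ℝ)..T, c (X t.toNNReal ω) t) ∂P =
      ∫ t in (0 : ℝ)..T, ∑ x, NormedSpace.exp (t • α) x₀ x * c x t := by
  have hsets : ∀ x, MeasurableSet {z : ℝ × Ω | X z.1.toNNReal z.2 = x} := fun x =>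
    h.measurable_uncurry (measurableSet_singleton x)
  have hsum : (Function.uncurry fun (t : ℝ) (ω : Ω) => c (X t.toNNReal ω) t) = fun z : ℝ × Ω =>
      ∑ x, {z : ℝ × Ω | X z.1.toNNReal z.2 = x}.indicator (fun z => c x z.1) z := by
    funext z
    simp [Function.uncurry, Set.indicator_apply]
  have hint : Integrable (Function.uncurry fun (t : ℝ) (ω : Ω) => c (X t.toNNReal ω) t)
      ((volume.restrict (Set.uIoc 0 T)).prod P) := by
    rw [hsum]
    refine integrable_finsetSum _ fun x _ => Integrable.indicator ?_ (hsets x)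
    refine Integrable.comp_fst ?_ P
    exact (intervalIntegrable_iff.1 ((hc x).intervalIntegrable 0 T))
  rw [← intervalIntegral_integral_swap hint]
  refine intervalIntegral.integral_congr fun t ht => ?_
  rw [Set.uIcc_of_le hT] at ht
  have h1 : (fun ω => c (X t.toNNReal ω) t) = fun ω =>
      ∑ x, {ω | X t.toNNReal ω = x}.indicator (fun _ => c x t) ω := by
    funext ω
    simp [Set.indicator_apply]
  have hset : ∀ x, MeasurableSet {ω | X t.toNNReal ω = x} := fun x =>
    h.measurable t.toNNReal (measurableSet_singleton x)
  simp only [h1]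
  rw [integral_finsetSum _ fun x _ => (integrable_const _).indicator (hset x)]
  refine Finset.sum_congr rfl fun x _ => ?_
  rw [integral_indicator (hset x), setIntegral_const, smul_eq_mul, ← h.lawFlow_eq ht.1]
  rfl

end IsJumpProcess

/-! ### Ergodic costs and stationary equilibria. -/

namespace Data

variable {M : Data d}

theorem off_diag_ge_of_mem_controls {α : Matrix (Fin d) (Fin d) ℝ} (hα : α ∈ M.controls) :
    ∀ x y, x ≠ y → M.al ≤ α x y := fun x y hxy => (hα.1 x y hxy).1

theorem lawFlow_mem {P : Measure Ω} [IsProbabilityMeasure P] {ℱ : Filtration ℝ≥0 mΩ}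
    {α : Matrix (Fin d) (Fin d) ℝ} {x₀ : Fin d} {X : ℝ≥0 → Ω → Fin d} (hal : 0 < M.al)
    (hα : α ∈ M.controls) (h : IsJumpProcess P ℱ α x₀ X) {t : ℝ} (ht : 0 ≤ t) :
    lawFlow P X t ∈ stdSimplex ℝ (Fin d) := by
  rw [h.lawFlow_eq ht]
  refine ⟨fun x => exp_entry_nonneg (fun x y hxy => ?_) x₀ x, exp_row_sum (fun x => ?_) x₀⟩
  · exact mul_nonneg ht (hal.le.trans (hα.1 x y hxy).1)
  · simp [← Finset.mul_sum, hα.2]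

/-- Verification: stationary costs are bounded below by the ergodic constant, and the excess is the
averaged defect of optimality in the Hamiltonian. -/
theorem IsErgodicTriple.stationary_cost_eq {φ : Fin d → ℝ} {ϱ : ℝ} {u μ : Fin d → ℝ}
    (h : M.IsErgodicTriple φ ϱ u μ) {α : Matrix (Fin d) (Fin d) ℝ} (hα : α ∈ M.controls)
    {π : Fin d → ℝ} (hπ : π ∈ stdSimplex ℝ (Fin d)) (hs : ∀ x, ∑ y, π y * α y x = 0) :
    ∑ x, π x * (M.f x (α x) + φ x) = ϱ +
      ∑ x, π x * (M.f x (α x) + ∑ y, α x y * diff x u y - M.H x (diff x u)) := by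
  -- The generator has zero average under a stationary distribution.
  have h1 : ∑ x, π x * ∑ y, α x y * diff x u y = 0 := by
    simp_rw [sum_mul_diff (hα.2 _), Finset.mul_sum]
    rw [Finset.sum_comm]
    simp_rw [← mul_assoc, ← Finset.sum_mul, hs, zero_mul, Finset.sum_const_zero]
  have h2 : ∑ x, π x * (M.H x (diff x u) + φ x) = ϱ := by
    simp_rw [h.hamiltonJacobi, ← Finset.sum_mul, hπ.2, one_mul]
  have h3 : ∑ x, π x * (M.f x (α x) + φ x) =
      ∑ x, π x * (M.H x (diff x u) + φ x) +
        ∑ x, π x * (M.f x (α x) + ∑ y, α x y * diff x u y - M.H x (diff x u)) -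
        ∑ x, π x * ∑ y, α x y * diff x u y := by
    rw [← Finset.sum_add_distrib, ← Finset.sum_sub_distrib]
    exact Finset.sum_congr rfl fun x _ => by ring
  rw [h3, h1, h2, sub_zero]

namespace Assumptions

variable (hM : M.Assumptions)
include hM

theorem tendsto_lawFlow {P : Measure Ω} [IsProbabilityMeasure P] {ℱ : Filtration ℝ≥0 mΩ}
    {α : Matrix (Fin d) (Fin d) ℝ} {x₀ : Fin d} {X : ℝ≥0 → Ω → Fin d}
    (hα : α ∈ M.controls) (h : IsJumpProcess P ℱ α x₀ X) {π : Fin d → ℝ}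
    (hπ : π ∈ stdSimplex ℝ (Fin d)) (hs : ∀ x, ∑ y, π y * α y x = 0) :
    Tendsto (lawFlow P X) atTop (𝓝 π) := by
  refine (tendsto_exp_row (Fin.pos x₀) hM.al_pos (off_diag_ge_of_mem_controls hα) hα.2 hπ hs
    x₀).congr' ?_
  filter_upwards [eventually_ge_atTop 0] with t ht
  rw [h.lawFlow_eq ht]

/-- The ergodic cost against a convergent flow is the stationary cost. -/
theorem ergodicCost_eq {P : Measure Ω} [IsProbabilityMeasure P] {ℱ : Filtration ℝ≥0 mΩ}
    {α : Matrix (Fin d) (Fin d) ℝ} {x₀ : Fin d} {X : ℝ≥0 → Ω → Fin d}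
    (hα : α ∈ M.controls) (h : IsJumpProcess P ℱ α x₀ X) {π : Fin d → ℝ}
    (hπ : π ∈ stdSimplex ℝ (Fin d)) (hs : ∀ x, ∑ y, π y * α y x = 0)
    {μ : ℝ → Fin d → ℝ} {η : Fin d → ℝ} (hμ : ∀ t, 0 ≤ t → μ t ∈ stdSimplex ℝ (Fin d))
    (hμc : ContinuousOn μ (Set.Ici 0)) (hη : η ∈ stdSimplex ℝ (Fin d))
    (hlim : Tendsto μ atTop (𝓝 η)) :
    M.ergodicCost P X α μ = ∑ x, π x * (M.f x (α x) + M.F x η) := by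
  -- The flow is controlled only for `t ≥ 0`; freezing it at its initial value before that gives an
  -- integrand continuous on the line.
  have hμ' : Continuous fun t : ℝ => μ (max t 0) :=
    hμc.comp_continuous (by fun_prop) fun t => Set.mem_Ici.2 (le_max_right _ _)
  set c : Fin d → ℝ → ℝ := fun x t => M.f x (α x) + M.F x (μ (max t 0)) with hcdef
  have hc : ∀ x, Continuous (c x) := fun x => continuous_const.add
    ((hM.continuousOn_F x).comp_continuous hμ' fun t => hμ _ (le_max_right _ _))
  have hg : Continuous fun t : ℝ => ∑ x, NormedSpace.exp (t • α) x₀ x * c x t :=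
    continuous_finsetSum _ fun x _ =>
      ((continuous_apply x).comp (contDiff_exp_smul_row α x₀).continuous).mul (hc x)
  have hclim : ∀ x, Tendsto (c x) atTop (𝓝 (M.f x (α x) + M.F x η)) := by
    intro x
    have h1 : Tendsto μ atTop (𝓝[stdSimplex ℝ (Fin d)] η) :=
      tendsto_nhdsWithin_iff.2 ⟨hlim, (eventually_ge_atTop 0).mono hμ⟩
    have h2 := ((hM.continuousOn_F x η hη).tendsto.comp h1).const_add (M.f x (α x))
    refine h2.congr' ?_
    filter_upwards [eventually_ge_atTop 0] with t ht
    simp [hcdef, max_eq_left ht]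
  have hglim : Tendsto (fun t : ℝ => ∑ x, NormedSpace.exp (t • α) x₀ x * c x t) atTop
      (𝓝 (∑ x, π x * (M.f x (α x) + M.F x η))) :=
    tendsto_finsetSum _ fun x _ => Tendsto.mul
      (tendsto_pi_nhds.1 (tendsto_exp_row (Fin.pos x₀) hM.al_pos
        (off_diag_ge_of_mem_controls hα) hα.2 hπ hs x₀) x) (hclim x)
  refine Tendsto.limsup_eq ((tendsto_cesaro_integral hg hglim).congr' ?_)
  filter_upwards [eventually_ge_atTop 0] with T hT
  rw [← h.integral_cost hc hT]
  congr 1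
  refine integral_congr_ae (Eventually.of_forall fun ω => ?_)
  refine intervalIntegral.integral_congr fun t ht => ?_
  rw [Set.uIcc_of_le hT] at ht
  simp only [hcdef, max_eq_left ht.1]

theorem feedback_mem (u : Fin d → ℝ) : M.feedback u ∈ M.controls :=
  mem_controls_iff.2 fun x => hM.gammaStar_mem x (diff x u)

theorem le_stationary_cost {φ : Fin d → ℝ} {ϱ : ℝ} {u μ : Fin d → ℝ}
    (h : M.IsErgodicTriple φ ϱ u μ) {α : Matrix (Fin d) (Fin d) ℝ} (hα : α ∈ M.controls)
    {π : Fin d → ℝ} (hπ : π ∈ stdSimplex ℝ (Fin d)) (hs : ∀ x, ∑ y, π y * α y x = 0) :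
    ϱ ≤ ∑ x, π x * (M.f x (α x) + φ x) := by
  rw [h.stationary_cost_eq hα hπ hs]
  have : 0 ≤ ∑ x, π x * (M.f x (α x) + ∑ y, α x y * diff x u y - M.H x (diff x u)) :=
    Finset.sum_nonneg fun x _ => mul_nonneg (hπ.1 x)
      (sub_nonneg.2 (hM.H_le (mem_controls_iff.1 hα x) _))
  linarith

theorem stationary_cost_feedback {φ : Fin d → ℝ} {ϱ : ℝ} {u μ : Fin d → ℝ}
    (h : M.IsErgodicTriple φ ϱ u μ) {π : Fin d → ℝ} (hπ : π ∈ stdSimplex ℝ (Fin d))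
    (hs : ∀ x, ∑ y, π y * M.feedback u y x = 0) :
    ∑ x, π x * (M.f x (M.feedback u x) + φ x) = ϱ := by
  rw [h.stationary_cost_eq (hM.feedback_mem u) hπ hs]
  have : ∀ x, M.f x (M.feedback u x) + ∑ y, M.feedback u x y * diff x u y = M.H x (diff x u) :=
    fun x => (hM.H_eq x _).symm
  simp [this]

/-- Optimal controls are the feedback controls. -/
theorem eq_feedback_of_stationary_cost_le {φ : Fin d → ℝ} {ϱ : ℝ} {u μ : Fin d → ℝ}
    (h : M.IsErgodicTriple φ ϱ u μ) {α : Matrix (Fin d) (Fin d) ℝ} (hα : α ∈ M.controls)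
    {π : Fin d → ℝ} (hπ : π ∈ stdSimplex ℝ (Fin d)) (hs : ∀ x, ∑ y, π y * α y x = 0)
    (hpos : ∀ x, 0 < π x) (hle : ∑ x, π x * (M.f x (α x) + φ x) ≤ ϱ) : α = M.feedback u := by
  have hnn : ∀ x ∈ Finset.univ,
      0 ≤ π x * (M.f x (α x) + ∑ y, α x y * diff x u y - M.H x (diff x u)) := fun x _ =>
    mul_nonneg (hπ.1 x) (sub_nonneg.2 (hM.H_le (mem_controls_iff.1 hα x) _))
  rw [h.stationary_cost_eq hα hπ hs] at hle
  have h0 := (Finset.sum_eq_zero_iff_of_nonneg hnn).1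
    (le_antisymm (by linarith) (Finset.sum_nonneg hnn))
  funext x
  have h1 := (mul_eq_zero.1 (h0 x (Finset.mem_univ x))).resolve_left (hpos x).ne'
  exact hM.eq_gammaStar (mem_controls_iff.1 hα x) (sub_eq_zero.1 h1)

theorem pos_of_stationary {α : Matrix (Fin d) (Fin d) ℝ} (hα : α ∈ M.controls)
    {π : Fin d → ℝ} (hπ : π ∈ stdSimplex ℝ (Fin d)) (hs : ∀ x, ∑ y, π y * α y x = 0) (x : Fin d) :
    0 < π x :=
  hM.lower_bound_pos.trans_le (le_of_stationary hM.al_pos (off_diag_ge_of_mem_controls hα)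
    (fun x => hM.diag_ge (mem_controls_iff.1 hα x))
    (mul_nonneg (Nat.cast_nonneg d) hM.au_pos.le) hπ hs x)

variable {P : Measure Ω} [IsProbabilityMeasure P] {ℱ : Filtration ℝ≥0 mΩ}
  {x₀ : Fin d} {X : Matrix (Fin d) (Fin d) ℝ → ℝ≥0 → Ω → Fin d}

/-- The ergodic system yields a stationary ergodic equilibrium. -/
theorem isStationaryErgodicMFE (hX : ∀ α ∈ M.controls, IsJumpProcess P ℱ α x₀ (X α))
    {ϱ : ℝ} {u μ : Fin d → ℝ} (h : M.IsErgodicSol ϱ u μ) :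
    M.IsStationaryErgodicMFE P X (M.feedback u) (lawFlow P (X (M.feedback u))) := by
  have ht := isErgodicSol_iff.1 h
  have hα := hM.feedback_mem u
  have hJ := hX _ hα
  have hlaw : ∀ t ∈ Set.Ici (0 : ℝ), lawFlow P (X (M.feedback u)) t =
      NormedSpace.exp (t • M.feedback u) x₀ := fun t ht => hJ.lawFlow_eq ht
  have hC1 : ContDiffOn ℝ 1 (lawFlow P (X (M.feedback u))) (Set.Ici 0) :=
    (contDiff_exp_smul_row _ x₀).contDiffOn.congr hlaw
  have hmem : ∀ t, 0 ≤ t → lawFlow P (X (M.feedback u)) t ∈ stdSimplex ℝ (Fin d) :=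
    fun t ht => lawFlow_mem hM.al_pos hα hJ ht
  have hlim := hM.tendsto_lawFlow hα hJ ht.mem ht.stationary
  refine ⟨hα, hmem, hC1, fun _ _ => rfl, fun β hβ => ?_⟩
  obtain ⟨π, hπ, hs⟩ := exists_stationary (Fin.pos x₀) hM.al_pos
    (off_diag_ge_of_mem_controls hβ) hβ.2
  rw [hM.ergodicCost_eq hα hJ ht.mem ht.stationary hmem hC1.continuousOn ht.mem hlim,
    hM.ergodicCost_eq hβ (hX β hβ) hπ hs hmem hC1.continuousOn ht.mem hlim,
    hM.stationary_cost_feedback ht ht.mem ht.stationary]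
  exact hM.le_stationary_cost ht hβ hπ hs

/-- Every stationary ergodic equilibrium comes from the ergodic system. -/
theorem eq_of_isStationaryErgodicMFE (hX : ∀ α ∈ M.controls, IsJumpProcess P ℱ α x₀ (X α))
    {ϱ : ℝ} {u μ : Fin d → ℝ} (h : M.IsErgodicSol ϱ u μ) {α : Matrix (Fin d) (Fin d) ℝ}
    {ν : ℝ → Fin d → ℝ} (hE : M.IsStationaryErgodicMFE P X α ν) :
    α = M.feedback u ∧ Tendsto ν atTop (𝓝 μ) ∧ ϱ = M.ergodicCost P (X α) α ν := by
  have hd := Fin.pos x₀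
  have hα := hE.control
  obtain ⟨π, hπ, hs⟩ := exists_stationary hd hM.al_pos (off_diag_ge_of_mem_controls hα) hα.2
  have hlim : Tendsto ν atTop (𝓝 π) := by
    refine (hM.tendsto_lawFlow hα (hX α hα) hπ hs).congr' ?_
    filter_upwards [eventually_ge_atTop 0] with t ht using hE.law t ht
  -- The coupling is frozen at `π`, hence constant and trivially monotone. No relation between `μ'`
  -- and `π` is known yet.
  obtain ⟨ϱ', u', μ', h'⟩ := hM.exists_isErgodicTriple hd (fun _ x => M.F x π)
    (fun _ => continuousOn_const) (by simp)
  have hfb := hM.feedback_mem u'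
  have hcost := hM.ergodicCost_eq hα (hX α hα) hπ hs hE.flow_mem hE.flow_C1.continuousOn hπ hlim
  have hcost' := hM.ergodicCost_eq hfb (hX _ hfb) h'.mem h'.stationary hE.flow_mem
    hE.flow_C1.continuousOn hπ hlim
  rw [hM.stationary_cost_feedback h' h'.mem h'.stationary] at hcost'
  have hle := hE.optimal _ hfb
  rw [hcost, hcost'] at hle
  have heq := hM.eq_feedback_of_stationary_cost_le h' hα hπ hs (hM.pos_of_stationary hα hπ hs) hle
  -- Since `α` is the feedback of `u'`, its stationary distribution `π` can take the place of `μ'`,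
  -- which closes the fixed point.
  have hsol : M.IsErgodicSol ϱ' u' π := isErgodicSol_iff.2
    ⟨h'.sum_eq_zero, hπ, h'.hamiltonJacobi, by rw [heq] at hs; exact hs⟩
  have huniq := (hM.existsUnique_isErgodicSol hd).unique (y₁ := (ϱ', u', π)) (y₂ := (ϱ, u, μ))
    hsol h
  simp only [Prod.mk.injEq] at huniq
  obtain ⟨rfl, rfl, rfl⟩ := huniq
  refine ⟨heq, hlim, ?_⟩
  rw [hcost]
  exact le_antisymm (hM.le_stationary_cost h' hα hπ hs) hle

end Assumptions

end Data

end Dynamics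

end FiniteMFG

theorem proposition2p1 {d : ℕ} (hd : 2 ≤ d) (M : FiniteMFG.Data d) (hM : M.Assumptions) :
    ∃ r₀ : ℝ, 0 < r₀ ∧
      -- (i) the stationary discounted system
      (∀ r ∈ Set.Ioo 0 r₀, ∃! s : (Fin d → ℝ) × (Fin d → ℝ), M.IsStatDiscountedSol r s.1 s.2) ∧
      (∃ C : ℝ, 0 < C ∧ ∀ r ∈ Set.Ioo 0 r₀, ∀ u μ, M.IsStatDiscountedSol r u μ →
        FiniteMFG.eucl (r • u) ≤ C ∧ ∀ x, C⁻¹ ≤ μ x) ∧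
      ((∀ x, ∀ a ∈ M.rateVectors x, ∀ η ∈ stdSimplex ℝ (Fin d), 0 < M.f x a + M.F x η) →
        ∀ r ∈ Set.Ioo 0 r₀, ∀ u μ, M.IsStatDiscountedSol r u μ → ∀ x, 0 < u x) ∧
      -- (ii) the ergodic system and the convergence
      (∃! s : ℝ × (Fin d → ℝ) × (Fin d → ℝ), M.IsErgodicSol s.1 s.2.1 s.2.2) ∧
      (∀ ϱ u μ, M.IsErgodicSol ϱ u μ →
        (∃ C : ℝ, 0 < C ∧ ∀ r ∈ Set.Ioo 0 r₀, ∀ ur μr, M.IsStatDiscountedSol r ur μr →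
          (⨆ x, |r * ur x - ϱ|) + FiniteMFG.diffNorm (ur - u) + FiniteMFG.eucl (μr - μ)
            ≤ C * r ^ (1 / 2 : ℝ)) ∧
        ∀ x, 0 < μ x) ∧
      -- (iii) the stationary ergodic equilibria, on any filtered probability space that carries
      -- the jump processes of the representative player started at `x₀`
      (∀ {Ω : Type*} {mΩ : MeasurableSpace Ω} (P : MeasureTheory.Measure Ω)
        [MeasureTheory.IsProbabilityMeasure P] (ℱ : MeasureTheory.Filtration NNReal mΩ)
        (x₀ : Fin d) (X : Matrix (Fin d) (Fin d) ℝ → NNReal → Ω → Fin d),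
        (∀ α ∈ M.controls, FiniteMFG.IsJumpProcess P ℱ α x₀ (X α)) →
        ∀ ϱ u μ, M.IsErgodicSol ϱ u μ →
          M.IsStationaryErgodicMFE P X (M.feedback u) (FiniteMFG.lawFlow P (X (M.feedback u))) ∧
          ∀ (α : Matrix (Fin d) (Fin d) ℝ) (ν : ℝ → Fin d → ℝ),
            M.IsStationaryErgodicMFE P X α ν →
              α = M.feedback u ∧ Filter.Tendsto ν Filter.atTop (nhds μ) ∧
              ϱ = M.ergodicCost P (X α) α ν) := by
  have hd0 : 0 < d := by omega
  obtain ⟨r₀, hr₀, h1, h2, h3⟩ := hM.stationary_systems hd0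
  refine ⟨r₀, hr₀, h1, h2, fun hpos r hr u μ h x => hM.discounted_pos hpos hr.1 h x,
    hM.existsUnique_isErgodicSol hd0, fun ϱ u μ h => ⟨h3 ϱ u μ h, fun x => ?_⟩, ?_⟩
  · exact hM.lower_bound_pos.trans_le (hM.stationary_lower_bound h.2.1 h.2.2.2 x)
  · intro Ω mΩ P _ ℱ x₀ X hX ϱ u μ h
    exact ⟨hM.isStationaryErgodicMFE hX h, fun α ν hE => hM.eq_of_isStationaryErgodicMFE hX h hE⟩
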